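/- Let $M$ be a smooth $n$-dimensional manifold. A Finsler metric on $M$ is a continuous function $F\colon TM\to[0,\infty)$, smooth and positive on $TM\setminus 0$, with $F(x,cy)=cF(x,y)$ for $c\ge 0$, whose fundamental tensor $g_{ij}=\frac12\frac{\partial^2F^2}{\partial y^i\partial y^j}$ is positive definite on $TM\setminus 0$. In natural coordinates $(x,y)$ of $TM$ its spray coefficients are $$G^i=\tfrac14 g^{ij}\Big(\frac{\partial^2F^2}{\partial x^k\partial y^j}y^k-\frac{\partial F^2}{\partial x^j}\Big);$$ with $N^i_j=\frac{\partial G^i}{\partial y^j}$ and $\frac{\delta}{\delta x^i}=\frac{\partial}{\partial x^i}-N^m_i\frac{\partial}{\partial y^m}$, the components of its Chern connection are $$\Gamma^i_{jk}=\tfrac12 g^{il}\Big(\frac{\delta g_{lk}}{\delta x^j}-\frac{\delta g_{jk}}{\delta x^l}+\frac{\delta g_{lj}}{\delta x^k}\Big),$$ and its Ricci scalar is $R=R^i_i$, where $$R^i_k=2\frac{\partial G^i}{\partial x^k}-y^m\frac{\partial^2G^i}{\partial x^m\partial y^k}+2G^m\frac{\partial^2G^i}{\partial y^m\partial y^k}-\frac{\partial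 G^i}{\partial y^m}\frac{\partial G^m}{\partial y^k}.$$ $F$ is called a Berwald metric if the $\Gamma^i_{jk}(x,y)$ do not depend on $y$; the $\Gamma^i_{jk}(x)$ are then the components of a linear connection $D$ on $M$. Let $F$ be a Finsler metric, $\Lambda$ a smooth positive function and $\omega$ a smooth one-form on $M$. Put $\beta=\omega/\Lambda$ and $G=(F^2/\Lambda+\beta^2)^{1/2}$. Suppose that $F/\sqrt\Lambda$ is a Berwald metric whose Ricci scalar vanishes on $TM\setminus 0$, and that $D\beta=0$, where $D$ is the linear connection induced by the Chern connection of $F/\sqrt\Lambda$. Then $G$ is a Berwald metric; $G+\beta$ is a Berwald metric (in particular both are Finsler metrics); $G+\beta$ has the same spray coefficients as $F/\sqrt\Lambda$ on $TM\setminus 0$; and the Ricci scalar of $G+\beta$ vanishes on $TM\setminus 0$. -/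

import Mathlib

open scoped Manifold ContDiff Bundle

noncomputable section

namespace Finsler

/-- The coordinate space `ℝⁿ`. -/
abbrev E (n : ℕ) : Type := EuclideanSpace ℝ (Fin n)

/-- The `i`-th standard basis vector of `ℝⁿ`. -/
def basisVec {n : ℕ} (i : Fin n) : E n := EuclideanSpace.single i 1

/-- The fundamental tensor of `f` (a positively homogeneous function of degree one on a real
vector space): `g(y)[u,v] = (1/2) ∂²/∂s∂t f²(y + s u + t v)` at `s = t = 0`. -/
def fundamentalTensor {V : Type*} [AddCommGroup V] [Module ℝ V] (f : V → ℝ) (y u v : V) : ℝ :=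
  (1 / 2) * deriv (fun s : ℝ => deriv (fun t : ℝ => f (y + s • u + t • v) ^ 2) 0) 0

section Coordinates

/-! Coordinate expressions. Here `f x y` is a function of the coordinates `x` of the point
and of the fibre coordinates `y`. -/

variable {n : ℕ}

/-- The partial derivative `∂f/∂xⁱ`. -/
def dx (i : Fin n) (f : E n → E n → ℝ) : E n → E n → ℝ :=
  fun x y => fderiv ℝ (fun x' => f x' y) x (basisVec i)

/-- The partial derivative `∂f/∂yⁱ`. -/
def dy (i : Fin n) (f : E n → E n → ℝ) : E n → E n → ℝ :=
  fun x y => fderiv ℝ (fun y' => f x y') y (basisVec i)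

/-- The matrix `g_{ij}(x,y)` of the fundamental tensor of `f`. -/
def gMat (f : E n → E n → ℝ) (x y : E n) : Matrix (Fin n) (Fin n) ℝ :=
  Matrix.of fun i j => fundamentalTensor (f x) y (basisVec i) (basisVec j)

/-- The spray coefficients
`Gⁱ = (1/4) g^{ij} (∂²f²/∂x^k∂y^j y^k - ∂f²/∂x^j)`. -/
def spray (f : E n → E n → ℝ) (i : Fin n) : E n → E n → ℝ :=
  fun x y => (1 / 4) * ∑ j, (gMat f x y)⁻¹ i j *
    ((∑ k, dx k (dy j (fun a b => f a b ^ 2)) x y * y k) - dx j (fun a b => f a b ^ 2) x y)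

/-- The coefficients `Nⁱ_j = ∂Gⁱ/∂y^j` of the nonlinear connection. -/
def nonlinearConn (f : E n → E n → ℝ) (i j : Fin n) : E n → E n → ℝ :=
  dy j (spray f i)

/-- The derivative `δh/δxⁱ = ∂h/∂xⁱ - N^m_i ∂h/∂y^m`, with `N` defined by `f`. -/
def delta (f : E n → E n → ℝ) (i : Fin n) (h : E n → E n → ℝ) : E n → E n → ℝ :=
  fun x y => dx i h x y - ∑ m, nonlinearConn f m i x y * dy m h x y

/-- The components `Γⁱ_{jk}(x,y)` of the Chern connection,
`(1/2) g^{il} (δg_{lk}/δx^j - δg_{jk}/δx^l + δg_{lj}/δx^k)`. -/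
def chern (f : E n → E n → ℝ) (i j k : Fin n) : E n → E n → ℝ :=
  fun x y => (1 / 2) * ∑ l, (gMat f x y)⁻¹ i l *
    (delta f j (fun a b => gMat f a b l k) x y
      - delta f l (fun a b => gMat f a b j k) x y
      + delta f k (fun a b => gMat f a b l j) x y)

/-- The components `Rⁱ_k(x,y)` of the Riemann curvature,
`2 ∂Gⁱ/∂x^k - y^m ∂²Gⁱ/∂x^m∂y^k + 2 G^m ∂²Gⁱ/∂y^m∂y^k - ∂Gⁱ/∂y^m ∂G^m/∂y^k`. -/
def riemann (f : E n → E n → ℝ) (i k : Fin n) : E n → E n → ℝ :=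
  fun x y => 2 * dx k (spray f i) x y
    - (∑ m, y m * dx m (dy k (spray f i)) x y)
    + 2 * (∑ m, spray f m x y * dy m (dy k (spray f i)) x y)
    - ∑ m, dy m (spray f i) x y * dy k (spray f m) x y

/-- The Finsler Ricci scalar `R = Rⁱ_i`. -/
def ricciScalar (f : E n → E n → ℝ) : E n → E n → ℝ :=
  fun x y => ∑ i, riemann f i i x y

end Coordinates

section Manifold

variable {n : ℕ} {M : Type*} [TopologicalSpace M] [ChartedSpace (E n) M]

/-- The expression of `F : TM → ℝ` in the natural coordinates `(x, y)` on `TM` associated with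
the chart `e`: the value of `F` at the tangent vector `yⁱ ∂/∂xⁱ` at the point with
coordinates `x`. -/
def localRep (F : TangentBundle (𝓡 n) M → ℝ) (e : OpenPartialHomeomorph M (E n)) :
    E n → E n → ℝ :=
  fun x y => F ⟨e.symm x, mfderiv (𝓡 n) (𝓡 n) e.symm x y⟩

/-- The component `β_i(x) = β(∂/∂xⁱ)` of a one-form in the chart `e`. -/
def oneFormCoord (β : ∀ p : M, TangentSpace (𝓡 n) p →L[ℝ] ℝ)
    (e : OpenPartialHomeomorph M (E n)) (i : Fin n) : E n → ℝ :=
  fun x => β (e.symm x) (mfderiv (𝓡 n) (𝓡 n) e.symm x (basisVec i))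

/-- A one-form is smooth if it is a smooth section of the cotangent bundle. -/
def IsSmoothOneForm (β : ∀ p : M, TangentSpace (𝓡 n) p →L[ℝ] ℝ)
    [IsManifold (𝓡 n) ∞ M] : Prop :=
  ContMDiff (𝓡 n) ((𝓡 n).prod 𝓘(ℝ, E n →L[ℝ] ℝ)) ∞
    (fun p : M => Bundle.TotalSpace.mk' (E n →L[ℝ] ℝ)
      (E := fun p : M => TangentSpace (𝓡 n) p →L[ℝ] Bundle.Trivial M ℝ p) p (β p))

/-- A Finsler metric on the smooth manifold `M`: a continuous function on `TM`, smooth and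
positive off the zero section, fibrewise positively homogeneous of degree one, with positive
definite fundamental tensor off the zero section. -/
structure IsFinslerMetric [IsManifold (𝓡 n) ∞ M] (F : TangentBundle (𝓡 n) M → ℝ) : Prop where
  continuous : Continuous F
  smooth : ContMDiffOn (𝓡 n).tangent 𝓘(ℝ) ∞ F {v | v.2 ≠ 0}
  pos : ∀ v : TangentBundle (𝓡 n) M, v.2 ≠ 0 → 0 < F v
  homogeneous : ∀ (p : M) (y : TangentSpace (𝓡 n) p) (c : ℝ), 0 ≤ c →
    F ⟨p, c • y⟩ = c * F ⟨p, y⟩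
  posDef : ∀ (p : M) (y u : TangentSpace (𝓡 n) p), y ≠ 0 → u ≠ 0 →
    0 < fundamentalTensor (fun w : TangentSpace (𝓡 n) p => F ⟨p, w⟩) y u u

/-- A Berwald metric: a Finsler metric for which, in every smooth chart, the components
`Γⁱ_{jk}(x,y)` of the Chern connection do not depend on `y`. -/
structure IsBerwald [IsManifold (𝓡 n) ∞ M] (F : TangentBundle (𝓡 n) M → ℝ) : Prop where
  isFinslerMetric : IsFinslerMetric F
  chern_eq : ∀ e ∈ IsManifold.maximalAtlas (𝓡 n) ∞ M, ∀ x ∈ e.target,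
    ∀ y y' : E n, y ≠ 0 → y' ≠ 0 → ∀ i j k : Fin n,
      chern (localRep F e) i j k x y = chern (localRep F e) i j k x y'

/-- The Finsler Ricci scalar of `F` vanishes on `TM` minus the zero section. -/
def RicciScalarVanishes (F : TangentBundle (𝓡 n) M → ℝ) : Prop :=
  ∀ e ∈ IsManifold.maximalAtlas (𝓡 n) ∞ M, ∀ x ∈ e.target, ∀ y : E n, y ≠ 0 →
    ricciScalar (localRep F e) x y = 0

/-- `F₁` and `F₂` have the same spray coefficients on `TM` minus the zero section. -/
def SameSpray (F₁ F₂ : TangentBundle (𝓡 n) M → ℝ) : Prop :=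
  ∀ e ∈ IsManifold.maximalAtlas (𝓡 n) ∞ M, ∀ x ∈ e.target, ∀ y : E n, y ≠ 0 →
    ∀ i : Fin n, spray (localRep F₁ e) i x y = spray (localRep F₂ e) i x y

/-- `Dβ = 0` for the Chern connection of `F`: in every smooth chart
`∂β_i/∂x^j - Γ^k_{ji}(x,y) β_k = 0`. It is meant for Berwald metrics, where `Γ^k_{ji}(x,y)` does
not depend on the auxiliary vector `y ≠ 0` and defines a linear connection on `M`. -/
def IsParallel (F : TangentBundle (𝓡 n) M → ℝ)
    (β : ∀ p : M, TangentSpace (𝓡 n) p →L[ℝ] ℝ) : Prop :=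
  ∀ e ∈ IsManifold.maximalAtlas (𝓡 n) ∞ M, ∀ x ∈ e.target, ∀ y : E n, y ≠ 0 →
    ∀ i j : Fin n, fderiv ℝ (oneFormCoord β e i) x (basisVec j)
      - ∑ k, chern (localRep F e) k j i x y * oneFormCoord β e k x = 0

/-- The function `F/√Λ` on `TM`. -/
def conformal (F : TangentBundle (𝓡 n) M → ℝ) (Λ : M → ℝ) : TangentBundle (𝓡 n) M → ℝ :=
  fun v => F v / √(Λ v.1)

/-- The one-form `β = om/Λ`. -/
def scaledForm (om : ∀ p : M, TangentSpace (𝓡 n) p →L[ℝ] ℝ) (Λ : M → ℝ) :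
    ∀ p : M, TangentSpace (𝓡 n) p →L[ℝ] ℝ :=
  fun p => (Λ p)⁻¹ • om p

/-- `G = (F²/Λ + β²)^{1/2}`, where `β = om/Λ`. -/
def metricG (F : TangentBundle (𝓡 n) M → ℝ) (Λ : M → ℝ)
    (om : ∀ p : M, TangentSpace (𝓡 n) p →L[ℝ] ℝ) : TangentBundle (𝓡 n) M → ℝ :=
  fun v => √(F v ^ 2 / Λ v.1 + scaledForm om Λ v.1 v.2 ^ 2)

/-- `G + β`, where `β = om/Λ`. -/
def metricGβ (F : TangentBundle (𝓡 n) M → ℝ) (Λ : M → ℝ)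
    (om : ∀ p : M, TangentSpace (𝓡 n) p →L[ℝ] ℝ) : TangentBundle (𝓡 n) M → ℝ :=
  fun v => metricG F Λ om v + scaledForm om Λ v.1 v.2

end Manifold

end Finsler

end

/-! Write `f` for F/√Λ. Both G and G + β have the form √(f² + β²) + cβ with |c| ≤ 1 (c = 0 and c =
1), so one argument serves for both.

The connection part rests on a characterization. Fix x and let Γ be coefficients symmetric in the
lower indices with ∂f²/∂xʲ = Γᵐⱼₖ yᵏ ∂f²/∂yᵐ for all y ≠ 0 (`IsCompatibleAt`): horizontal
differentiation along Γ kills f². Differentiating this identity in y gives Gⁱ = ½ Γⁱⱼₖ yʲyᵏ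
(`IsCompatibleAt.spray_eq`) and, after one more derivative and the Koszul combination, that the
Chern connection is Γ (`IsCompatibleAt.chern_eq`). Conversely, the Chern connection of any Finsler
metric satisfies the identity with coefficients depending on y (`IsLocalFinsler.dx_sq_eq`); for a
Berwald metric they depend on x alone. Since Dβ = 0 says that the same horizontal derivative kills y
↦ β(y), the chain rule shows that it kills (√(f² + β²) + cβ)² too (`IsCompatibleAt.randers`). Hence
the new metric has the Chern connection and the spray of `f`, and its Ricci scalar, built from the
spray alone, vanishes as well.

That the new function is a Finsler metric comes from |β| < √(f² + β²), which allows even |c| = 1,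
and from the second derivative of its square along a line: a square plus a positive multiple of a
positive definite form evaluated at the component of u transverse to y
(`IsLocalFinsler.fundamentalTensor_randers_pos`). -/

noncomputable section

namespace Finsler

/-! ### Partial derivatives in the coordinates (x, y). -/

section Calculus

variable {n : ℕ}

/-- A function of the coordinates `(x, y)` is smooth on `W`. -/
def SmoothOn (W : Set (E n × E n)) (f : E n → E n → ℝ) : Prop :=
  ContDiffOn ℝ ∞ (fun p : E n × E n => f p.1 p.2) W

variable {W : Set (E n × E n)} {f g : E n → E n → ℝ} {x y : E n}

theorem SmoothOn.contDiffAt (hf : SmoothOn W f) (hW : IsOpen W) (h : (x, y) ∈ W) :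
    ContDiffAt ℝ ∞ (fun p : E n × E n => f p.1 p.2) (x, y) :=
  ContDiffOn.contDiffAt hf (hW.mem_nhds h)

theorem SmoothOn.hasFDerivAt (hf : SmoothOn W f) (hW : IsOpen W) (h : (x, y) ∈ W) :
    HasFDerivAt (fun p : E n × E n => f p.1 p.2)
      (fderiv ℝ (fun p : E n × E n => f p.1 p.2) (x, y)) (x, y) :=
  ((hf.contDiffAt hW h).differentiableAt (by simp)).hasFDerivAt

theorem SmoothOn.contDiffAt_left (hf : SmoothOn W f) (hW : IsOpen W) (h : (x, y) ∈ W) :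
    ContDiffAt ℝ ∞ (fun a => f a y) x :=
  (hf.contDiffAt hW h).comp x (contDiffAt_id.prodMk contDiffAt_const)

theorem SmoothOn.contDiffAt_right (hf : SmoothOn W f) (hW : IsOpen W) (h : (x, y) ∈ W) :
    ContDiffAt ℝ ∞ (f x) y :=
  (hf.contDiffAt hW h).comp y (contDiffAt_const.prodMk contDiffAt_id)

theorem SmoothOn.differentiableAt_left (hf : SmoothOn W f) (hW : IsOpen W) (h : (x, y) ∈ W) :
    DifferentiableAt ℝ (fun a => f a y) x :=
  (hf.contDiffAt_left hW h).differentiableAt (by simp)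

theorem SmoothOn.differentiableAt_right (hf : SmoothOn W f) (hW : IsOpen W) (h : (x, y) ∈ W) :
    DifferentiableAt ℝ (f x) y :=
  (hf.contDiffAt_right hW h).differentiableAt (by simp)

/-- Reading partial derivatives off the total derivative lets smoothness and the symmetry of mixed
partials be inherited from the Fréchet derivative. -/
theorem SmoothOn.dx_eq (hf : SmoothOn W f) (hW : IsOpen W) (h : (x, y) ∈ W) (i : Fin n) :
    dx i f x y = fderiv ℝ (fun p : E n × E n => f p.1 p.2) (x, y) (basisVec i, 0) := by
  have h1 := HasFDerivAt.comp (f := fun a => (a, y)) x (hf.hasFDerivAt hW h)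
    ((hasFDerivAt_id x).prodMk (hasFDerivAt_const y x))
  have h2 : fderiv ℝ (fun a => f a y) x = _ := h1.fderiv
  simp [dx, h2]

theorem SmoothOn.dy_eq (hf : SmoothOn W f) (hW : IsOpen W) (h : (x, y) ∈ W) (i : Fin n) :
    dy i f x y = fderiv ℝ (fun p : E n × E n => f p.1 p.2) (x, y) (0, basisVec i) := by
  have h1 := HasFDerivAt.comp (f := fun b => (x, b)) y (hf.hasFDerivAt hW h)
    ((hasFDerivAt_const x y).prodMk (hasFDerivAt_id y))
  have h2 : fderiv ℝ (fun b => f x b) y = _ := h1.fderiv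
  simp [dy, h2]

theorem SmoothOn.fderiv_apply (hf : SmoothOn W f) (hW : IsOpen W) (v : E n × E n) :
    ContDiffOn ℝ ∞ (fun p => fderiv ℝ (fun p : E n × E n => f p.1 p.2) p v) W :=
  (ContDiffOn.fderiv_of_isOpen (m := ∞) hf hW (by simp)).clm_apply contDiffOn_const

theorem SmoothOn.dx (hf : SmoothOn W f) (hW : IsOpen W) (i : Fin n) : SmoothOn W (dx i f) :=
  (hf.fderiv_apply hW (basisVec i, 0)).congr fun _ hp => hf.dx_eq hW hp i

theorem SmoothOn.dy (hf : SmoothOn W f) (hW : IsOpen W) (i : Fin n) : SmoothOn W (dy i f) :=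
  (hf.fderiv_apply hW (0, basisVec i)).congr fun _ hp => hf.dy_eq hW hp i

theorem SmoothOn.fderiv_fderiv_comm (hf : SmoothOn W f) (hW : IsOpen W) (h : (x, y) ∈ W)
    (u v : E n × E n) :
    fderiv ℝ (fun q => fderiv ℝ (fun p : E n × E n => f p.1 p.2) q v) (x, y) u =
      fderiv ℝ (fun q => fderiv ℝ (fun p : E n × E n => f p.1 p.2) q u) (x, y) v := by
  have hs := (hf.contDiffAt hW h).isSymmSndFDerivAt
    (by simpa using WithTop.coe_le_coe.2 (le_top : (2 : ℕ∞) ≤ ⊤))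
  have hd : DifferentiableAt ℝ (fderiv ℝ (fun p : E n × E n => f p.1 p.2)) (x, y) :=
    ((ContDiffOn.fderiv_of_isOpen (m := ∞) hf hW (by simp)).contDiffAt
      (hW.mem_nhds h)).differentiableAt (by simp)
  have key : ∀ u v : E n × E n,
      fderiv ℝ (fun q => fderiv ℝ (fun p : E n × E n => f p.1 p.2) q v) (x, y) u =
        fderiv ℝ (fderiv ℝ (fun p : E n × E n => f p.1 p.2)) (x, y) u v := by
    intro u v
    rw [fderiv_clm_apply hd (differentiableAt_const v)]
    simp
  rw [key, key]
  exact hs.eq u v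

theorem SmoothOn.dx_dy_comm (hf : SmoothOn W f) (hW : IsOpen W) (h : (x, y) ∈ W)
    (i j : Fin n) : Finsler.dx i (Finsler.dy j f) x y = Finsler.dy j (Finsler.dx i f) x y := by
  rw [(hf.dy hW j).dx_eq hW h, (hf.dx hW i).dy_eq hW h]
  have e1 : (fun p : E n × E n => Finsler.dy j f p.1 p.2) =ᶠ[nhds (x, y)]
      fun q => fderiv ℝ (fun p : E n × E n => f p.1 p.2) q (0, basisVec j) :=
    Filter.eventuallyEq_of_mem (hW.mem_nhds h) fun p hp => hf.dy_eq hW hp j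
  have e2 : (fun p : E n × E n => Finsler.dx i f p.1 p.2) =ᶠ[nhds (x, y)]
      fun q => fderiv ℝ (fun p : E n × E n => f p.1 p.2) q (basisVec i, 0) :=
    Filter.eventuallyEq_of_mem (hW.mem_nhds h) fun p hp => hf.dx_eq hW hp i
  rw [e1.fderiv_eq, e2.fderiv_eq]
  exact hf.fderiv_fderiv_comm hW h _ _

theorem SmoothOn.dy_dy_comm (hf : SmoothOn W f) (hW : IsOpen W) (h : (x, y) ∈ W)
    (i j : Fin n) : Finsler.dy i (Finsler.dy j f) x y = Finsler.dy j (Finsler.dy i f) x y := by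
  have e (j : Fin n) : (fun p : E n × E n => Finsler.dy j f p.1 p.2) =ᶠ[nhds (x, y)]
      fun q => fderiv ℝ (fun p : E n × E n => f p.1 p.2) q (0, basisVec j) :=
    Filter.eventuallyEq_of_mem (hW.mem_nhds h) fun p hp => hf.dy_eq hW hp j
  rw [(hf.dy hW j).dy_eq hW h, (hf.dy hW i).dy_eq hW h, (e j).fderiv_eq, (e i).fderiv_eq]
  exact hf.fderiv_fderiv_comm hW h _ _

theorem dx_congr (hW : IsOpen W) (hfg : ∀ p ∈ W, f p.1 p.2 = g p.1 p.2) (h : (x, y) ∈ W)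
    (i : Fin n) : dx i f x y = dx i g x y := by
  have : (fun a => f a y) =ᶠ[nhds x] fun a => g a y :=
    Filter.eventuallyEq_of_mem
      ((Continuous.prodMk_left y).continuousAt.preimage_mem_nhds (hW.mem_nhds h))
      fun a ha => hfg (a, y) ha
  simp only [dx, this.fderiv_eq]

theorem dy_congr_of_eventuallyEq (hfg : f x =ᶠ[nhds y] g x) (i : Fin n) :
    dy i f x y = dy i g x y := by
  have : (fun b => f x b) =ᶠ[nhds y] fun b => g x b := hfg
  simp only [dy, this.fderiv_eq]

/-- Only the fibre over the single point x matters, so identities known at one x can still be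
differentiated in y. -/
theorem dy_congr_of_ne_zero (hfg : ∀ b ≠ 0, f x b = g x b) (hy : y ≠ 0) (i : Fin n) :
    dy i f x y = dy i g x y :=
  dy_congr_of_eventuallyEq
    (Filter.eventuallyEq_of_mem (isOpen_compl_singleton.mem_nhds hy) fun b hb => hfg b hb) i

theorem dy_congr (hW : IsOpen W) (hfg : ∀ p ∈ W, f p.1 p.2 = g p.1 p.2) (h : (x, y) ∈ W)
    (i : Fin n) : dy i f x y = dy i g x y :=
  dy_congr_of_eventuallyEq
    (Filter.eventuallyEq_of_mem
      ((Continuous.prodMk_right x).continuousAt.preimage_mem_nhds (hW.mem_nhds h))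
      fun b hb => hfg (x, b) hb) i

/-- Linearity of `∂/∂xⁱ` on finite sums with coefficients depending on `y`. -/
theorem dx_sum_mul {ι : Type*} (s : Finset ι) (c : ι → E n → ℝ) (F : ι → E n → E n → ℝ)
    (hF : ∀ k ∈ s, DifferentiableAt ℝ (fun a => F k a y) x) (i : Fin n) :
    dx i (fun a b => ∑ k ∈ s, c k b * F k a b) x y = ∑ k ∈ s, c k y * dx i (F k) x y := by
  have : HasFDerivAt (fun a => ∑ k ∈ s, c k y * F k a y)
      (∑ k ∈ s, c k y • fderiv ℝ (fun a => F k a y) x) x :=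
    HasFDerivAt.fun_sum fun k hk => (hF k hk).hasFDerivAt.const_mul (c k y)
  simp [dx, this.fderiv]

/-- The Leibniz rule for `∂/∂yⁱ` on finite sums of products. -/
theorem dy_sum_mul {ι : Type*} (s : Finset ι) (c F : ι → E n → E n → ℝ)
    (hc : ∀ k ∈ s, DifferentiableAt ℝ (c k x) y)
    (hF : ∀ k ∈ s, DifferentiableAt ℝ (F k x) y) (i : Fin n) :
    dy i (fun a b => ∑ k ∈ s, c k a b * F k a b) x y =
      ∑ k ∈ s, (dy i (c k) x y * F k x y + c k x y * dy i (F k) x y) := by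
  have : HasFDerivAt (fun b => ∑ k ∈ s, c k x b * F k x b)
      (∑ k ∈ s, (c k x y • fderiv ℝ (F k x) y + F k x y • fderiv ℝ (c k x) y)) y :=
    HasFDerivAt.fun_sum fun k hk => (hc k hk).hasFDerivAt.mul (hF k hk).hasFDerivAt
  simp only [dy, this.fderiv, sum_apply]
  refine Finset.sum_congr rfl fun k _ => ?_
  simp only [add_apply, smul_apply, smul_eq_mul]
  ring

theorem differentiableAt_coord (k : Fin n) : DifferentiableAt ℝ (fun b : E n => b k) y :=
  (EuclideanSpace.proj (𝕜 := ℝ) k).differentiableAt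

theorem dy_coord (i k : Fin n) :
    dy i (fun _ b => b k) x y = if k = i then 1 else 0 := by
  have : HasFDerivAt (fun b : E n => b k) (EuclideanSpace.proj (𝕜 := ℝ) k) y :=
    (EuclideanSpace.proj (𝕜 := ℝ) k).hasFDerivAt
  simp [dy, this.fderiv, basisVec]

theorem sum_smul_basisVec (y : E n) : ∑ k, y k • basisVec k = y := by
  ext i
  simp [basisVec, Pi.single_apply]

theorem fderiv_apply_eq_sum_dy (f : E n → E n → ℝ) (x y u : E n) :
    fderiv ℝ (f x) y u = ∑ k, u k * dy k f x y := by
  conv_lhs => rw [← sum_smul_basisVec u]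
  simp [dy]

end Calculus

/-! ### The fundamental tensor as a second derivative. -/

section FundamentalTensor

variable {V : Type*} [NormedAddCommGroup V] [NormedSpace ℝ V] {f : V → ℝ} {y : V}

theorem hasDerivAt_line {φ : V → ℝ} {y u : V} {s : ℝ}
    (h : DifferentiableAt ℝ φ (y + s • u)) :
    HasDerivAt (fun r : ℝ => φ (y + r • u)) (fderiv ℝ φ (y + s • u) u) s := by
  have hl : HasDerivAt (fun r : ℝ => y + r • u) u s := by
    simpa using ((hasDerivAt_id s).smul_const u).const_add y
  exact h.hasFDerivAt.comp_hasDerivAt s hl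

theorem continuous_line (y u : V) : Continuous fun r : ℝ => y + r • u := by fun_prop

theorem eventually_line {S : Set V} (hS : IsOpen S) (hy : y ∈ S) (u : V) :
    ∀ᶠ s : ℝ in nhds 0, y + s • u ∈ S :=
  (continuous_line y u).continuousAt.preimage_mem_nhds (by simpa using hS.mem_nhds hy)

theorem fundamentalTensor_eq {S : Set V} (hS : IsOpen S)
    (hf : ContDiffOn ℝ ∞ (fun w => f w ^ 2) S) (hy : y ∈ S) (u v : V) :
    fundamentalTensor f y u v =
      1 / 2 * fderiv ℝ (fun w => fderiv ℝ (fun w => f w ^ 2) w v) y u := by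
  have hd : DifferentiableAt ℝ (fun w => fderiv ℝ (fun w => f w ^ 2) w v) (y + (0 : ℝ) • u) := by
    have := ((hf.fderiv_of_isOpen (m := ∞) hS (by simp)).contDiffAt
      (hS.mem_nhds hy)).differentiableAt (by simp)
    simpa using this.clm_apply (differentiableAt_const v)
  have h1 : (fun s : ℝ => deriv (fun t : ℝ => f (y + s • u + t • v) ^ 2) 0) =ᶠ[nhds 0]
      fun s => fderiv ℝ (fun w => f w ^ 2) (y + s • u) v := by
    filter_upwards [eventually_line hS hy u] with s hs
    have := hasDerivAt_line (φ := fun w => f w ^ 2) (y := y + s • u) (u := v) (s := 0)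
      (by simpa using (hf.contDiffAt (hS.mem_nhds hs)).differentiableAt (by simp))
    simpa using this.deriv
  rw [fundamentalTensor, h1.deriv_eq, (hasDerivAt_line hd).deriv]
  simp

theorem fundamentalTensor_self {V : Type*} [AddCommGroup V] [Module ℝ V] (f : V → ℝ) (y u : V) :
    fundamentalTensor f y u u =
      1 / 2 * deriv (deriv fun r : ℝ => f (y + r • u) ^ 2) 0 := by
  have : (fun s : ℝ => deriv (fun t : ℝ => f (y + s • u + t • u) ^ 2) 0) =
      deriv fun r : ℝ => f (y + r • u) ^ 2 := by
    funext s
    have := deriv_comp_const_add (fun r : ℝ => f (y + r • u) ^ 2) s 0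
    simpa [add_smul, add_assoc] using this
  rw [fundamentalTensor, this]

/-- Carries positive definiteness between a tangent space and its coordinates. -/
theorem fundamentalTensor_comp {V V' : Type*} [AddCommGroup V] [Module ℝ V] [AddCommGroup V']
    [Module ℝ V'] (A : V →ₗ[ℝ] V') (f : V' → ℝ) (y u v : V) :
    fundamentalTensor (fun w => f (A w)) y u v = fundamentalTensor f (A y) (A u) (A v) := by
  simp [fundamentalTensor]

end FundamentalTensor

/-! ### Euler identities for a Finsler metric in coordinates. -/

section Coordinates

variable {n : ℕ}

/-- The properties of the coordinate expression of a Finsler metric over the open set `U`. -/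
structure IsLocalFinsler (U : Set (E n)) (f : E n → E n → ℝ) : Prop where
  isOpen : IsOpen U
  smooth : SmoothOn (U ×ˢ {0}ᶜ) f
  pos : ∀ x ∈ U, ∀ y ≠ 0, 0 < f x y
  homogeneous : ∀ x ∈ U, ∀ (y : E n) (c : ℝ), 0 ≤ c → f x (c • y) = c * f x y
  posDef : ∀ x ∈ U, ∀ y u : E n, y ≠ 0 → u ≠ 0 → 0 < fundamentalTensor (f x) y u u

namespace IsLocalFinsler

variable {U : Set (E n)} {f : E n → E n → ℝ} {x y : E n}

theorem isOpen_prod (hf : IsLocalFinsler U f) : IsOpen (U ×ˢ ({0}ᶜ : Set (E n))) :=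
  hf.isOpen.prod isOpen_compl_singleton

theorem smooth_sq (hf : IsLocalFinsler U f) : SmoothOn (U ×ˢ {0}ᶜ) fun a b => f a b ^ 2 :=
  ContDiffOn.pow hf.smooth 2

theorem contDiffOn_sq (hf : IsLocalFinsler U f) (hx : x ∈ U) :
    ContDiffOn ℝ ∞ (fun b => f x b ^ 2) {0}ᶜ := fun b hb =>
  (hf.smooth_sq.contDiffAt_right hf.isOpen_prod (y := b) ⟨hx, hb⟩).contDiffWithinAt

theorem gMat_eq (hf : IsLocalFinsler U f) (hx : x ∈ U) (hy : y ≠ 0) (i j : Fin n) :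
    gMat f x y i j = 1 / 2 * dy i (dy j fun a b => f a b ^ 2) x y :=
  fundamentalTensor_eq isOpen_compl_singleton (hf.contDiffOn_sq hx) hy _ _

theorem gMat_symm (hf : IsLocalFinsler U f) (hx : x ∈ U) (hy : y ≠ 0) (i j : Fin n) :
    gMat f x y i j = gMat f x y j i := by
  rw [hf.gMat_eq hx hy, hf.gMat_eq hx hy, hf.smooth_sq.dy_dy_comm hf.isOpen_prod ⟨hx, hy⟩]

theorem smooth_gMat (hf : IsLocalFinsler U f) (i j : Fin n) :
    SmoothOn (U ×ˢ {0}ᶜ) fun a b => gMat f a b i j := by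
  have := ((hf.smooth_sq.dy hf.isOpen_prod j).dy hf.isOpen_prod i)
  exact (contDiffOn_const (c := (1 / 2 : ℝ)).mul this).congr fun p hp => hf.gMat_eq hp.1 hp.2 i j

theorem fundamentalTensor_eq_sum (hf : IsLocalFinsler U f) (hx : x ∈ U) (hy : y ≠ 0)
    (u v : E n) : fundamentalTensor (f x) y u v = ∑ i, ∑ j, u i * (gMat f x y i j * v j) := by
  rw [fundamentalTensor_eq isOpen_compl_singleton (hf.contDiffOn_sq hx) hy]
  have h1 (w : E n) : fderiv ℝ (fun b => f x b ^ 2) w v =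
      ∑ j, v j * dy j (fun a b => f a b ^ 2) x w :=
    fderiv_apply_eq_sum_dy (fun a b => f a b ^ 2) x w v
  simp_rw [h1]
  rw [fderiv_apply_eq_sum_dy (fun a b => ∑ j, v j * dy j (fun a b => f a b ^ 2) a b) x y u,
    Finset.mul_sum]
  refine Finset.sum_congr rfl fun i _ => ?_
  rw [dy_sum_mul Finset.univ (fun j _ _ => v j) (fun j => dy j fun a b => f a b ^ 2)
    (fun _ _ => differentiableAt_const _) fun j _ =>
      (hf.smooth_sq.dy hf.isOpen_prod j).differentiableAt_right hf.isOpen_prod ⟨hx, hy⟩,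
    Finset.mul_sum, Finset.mul_sum]
  refine Finset.sum_congr rfl fun j _ => ?_
  rw [hf.gMat_eq hx hy]
  have : dy i (fun _ _ => v j) x y = 0 := by simp [dy]
  rw [this]
  ring

/-- Guarantees that the matrix inverse in the spray and in the Chern connection is a genuine inverse
and not the default value. -/
theorem isUnit_gMat (hf : IsLocalFinsler U f) (hx : x ∈ U) (hy : y ≠ 0) :
    IsUnit (gMat f x y).det := by
  have : (gMat f x y).PosDef := by
    refine Matrix.PosDef.of_dotProduct_mulVec_pos (Matrix.IsHermitian.ext fun i j => ?_)
      fun u hu => ?_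
    · simpa using hf.gMat_symm hx hy j i
    · have := hf.posDef x hx y (WithLp.toLp 2 u) hy (by simpa using hu)
      rw [hf.fundamentalTensor_eq_sum hx hy] at this
      simpa [dotProduct, Matrix.mulVec, Finset.mul_sum] using this
  exact (Matrix.isUnit_iff_isUnit_det _).1 this.isUnit

theorem sum_inv_mul (hf : IsLocalFinsler U f) (hx : x ∈ U) (hy : y ≠ 0) (i m : Fin n) :
    ∑ l, (gMat f x y)⁻¹ i l * gMat f x y l m = if i = m then 1 else 0 := by
  have := congrFun (congrFun (Matrix.nonsing_inv_mul _ (hf.isUnit_gMat hx hy)) i) m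
  simpa [Matrix.mul_apply, Matrix.one_apply] using this

theorem sum_mul_inv (hf : IsLocalFinsler U f) (hx : x ∈ U) (hy : y ≠ 0) (i m : Fin n) :
    ∑ l, gMat f x y i l * (gMat f x y)⁻¹ l m = if i = m then 1 else 0 := by
  have := congrFun (congrFun (Matrix.mul_nonsing_inv _ (hf.isUnit_gMat hx hy)) i) m
  simpa [Matrix.mul_apply, Matrix.one_apply] using this

/-- Euler's relation for f², homogeneous of degree two. Homogeneity is assumed for nonnegative
factors only, hence the restriction to 1 + r > 0. -/
theorem fderiv_sq_self (hf : IsLocalFinsler U f) (hx : x ∈ U) (hy : y ≠ 0) :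
    fderiv ℝ (fun b => f x b ^ 2) y y = 2 * f x y ^ 2 := by
  have h1 := hasDerivAt_line (φ := fun b => f x b ^ 2) (y := y) (u := y) (s := 0)
    (by simpa using hf.smooth_sq.differentiableAt_right hf.isOpen_prod ⟨hx, hy⟩)
  have h2 : (fun r : ℝ => f x (y + r • y) ^ 2) =ᶠ[nhds 0]
      fun r => (1 + r) ^ 2 * f x y ^ 2 := by
    filter_upwards [lt_mem_nhds (show (-1 : ℝ) < 0 by norm_num)] with r hr
    have : y + r • y = (1 + r) • y := by rw [add_smul, one_smul]
    rw [this, hf.homogeneous x hx y _ (by linarith)]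
    ring
  have h3 : HasDerivAt (fun r : ℝ => (1 + r) ^ 2 * f x y ^ 2) (2 * f x y ^ 2) 0 := by
    have := (((hasDerivAt_id (0 : ℝ)).const_add 1).pow 2).mul_const (f x y ^ 2)
    simpa using this
  have := (h1.congr_of_eventuallyEq h2.symm).unique h3
  simpa using this

theorem sum_mul_dy_sq (hf : IsLocalFinsler U f) (hx : x ∈ U) (hy : y ≠ 0) :
    ∑ k, y k * dy k (fun a b => f a b ^ 2) x y = 2 * f x y ^ 2 := by
  rw [← fderiv_apply_eq_sum_dy (fun a b => f a b ^ 2) x y y]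
  exact hf.fderiv_sq_self hx hy

theorem sum_gMat_mul (hf : IsLocalFinsler U f) (hx : x ∈ U) (hy : y ≠ 0) (m : Fin n) :
    ∑ k, y k * gMat f x y m k = 1 / 2 * dy m (fun a b => f a b ^ 2) x y := by
  -- Euler's relation is differentiated in yᵐ. The one-term sum over `Fin 1` puts the right side in
  -- the shape of `dy_sum_mul`.
  have h1 := dy_congr_of_ne_zero (f := fun a b => ∑ k, b k * dy k (fun a b => f a b ^ 2) a b)
    (g := fun a b => ∑ _ : Fin 1, 2 * f a b ^ 2) (x := x)
    (fun b hb => by simpa using hf.sum_mul_dy_sq hx hb) hy m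
  rw [dy_sum_mul _ _ _ (fun k _ => differentiableAt_coord k) fun k _ =>
      (hf.smooth_sq.dy hf.isOpen_prod k).differentiableAt_right hf.isOpen_prod ⟨hx, hy⟩,
    dy_sum_mul _ (fun _ _ _ => 2) (fun _ a b => f a b ^ 2) (fun _ _ => differentiableAt_const _)
      fun _ _ => hf.smooth_sq.differentiableAt_right hf.isOpen_prod ⟨hx, hy⟩] at h1
  have h0 : dy m (fun _ _ => 2) x y = 0 := by simp [dy]
  simp only [dy_coord, h0, Finset.sum_add_distrib] at h1
  simp at h1
  simp_rw [hf.gMat_eq hx hy, mul_left_comm _ (1 / 2 : ℝ), ← Finset.mul_sum]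
  linarith

theorem sum_sum_gMat (hf : IsLocalFinsler U f) (hx : x ∈ U) (hy : y ≠ 0) :
    ∑ l, ∑ k, y l * y k * gMat f x y l k = f x y ^ 2 := by
  simp_rw [mul_assoc, ← Finset.mul_sum, hf.sum_gMat_mul hx hy, mul_left_comm _ (1 / 2 : ℝ),
    ← Finset.mul_sum, hf.sum_mul_dy_sq hx hy]
  ring

theorem sum_sum_dx_gMat (hf : IsLocalFinsler U f) (hx : x ∈ U) (hy : y ≠ 0) (j : Fin n) :
    ∑ l, ∑ k, y l * y k * dx j (fun a b => gMat f a b l k) x y =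
      dx j (fun a b => f a b ^ 2) x y := by
  rw [dx_congr (g := fun a b => ∑ p : Fin n × Fin n, b p.1 * b p.2 * gMat f a b p.1 p.2)
    hf.isOpen_prod (fun p hp => by
      rw [Fintype.sum_prod_type]; exact (hf.sum_sum_gMat hp.1 hp.2).symm) ⟨hx, hy⟩,
    dx_sum_mul Finset.univ (fun (p : Fin n × Fin n) b => b p.1 * b p.2)
      (fun p a b => gMat f a b p.1 p.2) (fun p _ =>
        (hf.smooth_gMat p.1 p.2).differentiableAt_left hf.isOpen_prod ⟨hx, hy⟩),
    Fintype.sum_prod_type]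

/-- Differentiate gₗₖ yˡyᵏ = f² in yᵐ: the two terms in which a factor y is differentiated already
add up to ∂f²/∂yᵐ. -/
theorem sum_sum_dy_gMat (hf : IsLocalFinsler U f) (hx : x ∈ U) (hy : y ≠ 0) (m : Fin n) :
    ∑ l, ∑ k, y l * y k * dy m (fun a b => gMat f a b l k) x y = 0 := by
  have hg (p : Fin n × Fin n) : DifferentiableAt ℝ (fun b => gMat f x b p.1 p.2) y :=
    (hf.smooth_gMat p.1 p.2).differentiableAt_right hf.isOpen_prod ⟨hx, hy⟩
  have h1 := dy_congr_of_ne_zero (g := fun a b => f a b ^ 2)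
    (f := fun a b => ∑ p : Fin n × Fin n, b p.1 * (b p.2 * gMat f a b p.1 p.2)) (x := x)
    (fun b hb => by
      rw [Fintype.sum_prod_type, ← hf.sum_sum_gMat hx hb]
      simp_rw [mul_assoc]) hy m
  rw [dy_sum_mul Finset.univ (fun p _ b => b p.1) (fun p a b => b p.2 * gMat f a b p.1 p.2)
    (fun p _ => differentiableAt_coord p.1)
    (fun p _ => (differentiableAt_coord p.2).mul (hg p))] at h1
  have h2 (p : Fin n × Fin n) : dy m (fun a b => b p.2 * gMat f a b p.1 p.2) x y =
      (if p.2 = m then 1 else 0) * gMat f x y p.1 p.2 +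
        y p.2 * dy m (fun a b => gMat f a b p.1 p.2) x y := by
    have := dy_sum_mul (x := x) (y := y) {p} (fun p _ b => b p.2)
      (fun p a b => gMat f a b p.1 p.2) (fun p _ => differentiableAt_coord p.2)
      (fun p _ => hg p) m
    simpa [dy_coord] using this
  simp only [h2, dy_coord, Fintype.sum_prod_type, Finset.sum_add_distrib, mul_add,
    ite_mul, one_mul, zero_mul, mul_ite, mul_zero, Finset.sum_ite_eq',
    Finset.mem_univ, if_true] at h1
  have h3 : ∑ l, ∑ k, (if l = m then y k * gMat f x y l k else 0) =
      ∑ k, y k * gMat f x y m k := by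
    rw [Finset.sum_comm]; simp
  have h4 : ∑ l, y l * gMat f x y l m = ∑ k, y k * gMat f x y m k :=
    Finset.sum_congr rfl fun l _ => by rw [hf.gMat_symm hx hy]
  simp only [h3, h4, hf.sum_gMat_mul hx hy] at h1
  simp_rw [mul_assoc]
  linarith

end IsLocalFinsler

end Coordinates

/-! ### Linear connections annihilating f² and the Chern connection. -/

section Coordinates

variable {n : ℕ}

namespace IsLocalFinsler

variable {U : Set (E n)} {f : E n → E n → ℝ} {x y : E n}

theorem sum_inv_mul_sum (hf : IsLocalFinsler U f) (hx : x ∈ U) (hy : y ≠ 0) (i : Fin n)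
    (c : Fin n → ℝ) : ∑ l, (gMat f x y)⁻¹ i l * ∑ m, gMat f x y l m * c m = c i := by
  simp_rw [Finset.mul_sum]
  rw [Finset.sum_comm]
  simp_rw [← mul_assoc, ← Finset.sum_mul, hf.sum_inv_mul hx hy]
  simp

theorem delta_gMat_symm (hf : IsLocalFinsler U f) (hx : x ∈ U) (hy : y ≠ 0) (j l k : Fin n) :
    delta f j (fun a b => gMat f a b l k) x y = delta f j (fun a b => gMat f a b k l) x y := by
  have hsymm : ∀ p ∈ U ×ˢ ({0}ᶜ : Set (E n)), gMat f p.1 p.2 l k = gMat f p.1 p.2 k l :=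
    fun p hp => hf.gMat_symm hp.1 hp.2 l k
  simp only [delta]
  rw [dx_congr (f := fun a b => gMat f a b l k) (g := fun a b => gMat f a b k l)
    hf.isOpen_prod hsymm ⟨hx, hy⟩]
  simp_rw [dy_congr (f := fun a b => gMat f a b l k) (g := fun a b => gMat f a b k l)
    hf.isOpen_prod hsymm ⟨hx, hy⟩]

theorem chern_symm (hf : IsLocalFinsler U f) (hx : x ∈ U) (hy : y ≠ 0) (i j k : Fin n) :
    chern f i j k x y = chern f i k j x y := by
  simp only [chern]
  congr 1
  refine Finset.sum_congr rfl fun l _ => ?_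
  rw [hf.delta_gMat_symm hx hy l j k]
  ring

/-- The Chern connection in terms of its defining Christoffel symbols of the first kind. -/
theorem sum_gMat_mul_chern (hf : IsLocalFinsler U f) (hx : x ∈ U) (hy : y ≠ 0) (i j k : Fin n) :
    ∑ m, gMat f x y i m * chern f m j k x y =
      1 / 2 * (delta f j (fun a b => gMat f a b i k) x y
        - delta f i (fun a b => gMat f a b j k) x y
        + delta f k (fun a b => gMat f a b i j) x y) := by
  simp only [chern, mul_left_comm _ (1 / 2 : ℝ), ← Finset.mul_sum]
  congr 1
  simp_rw [Finset.mul_sum]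
  rw [Finset.sum_comm]
  simp_rw [← mul_assoc, ← Finset.sum_mul, hf.sum_mul_inv hx hy]
  simp

/-- The horizontal derivative of `f²` vanishes, expressed through the Chern connection. -/
theorem dx_sq_eq (hf : IsLocalFinsler U f) (hx : x ∈ U) (hy : y ≠ 0) (j : Fin n) :
    dx j (fun a b => f a b ^ 2) x y =
      ∑ m, (∑ k, chern f m j k x y * y k) * dy m (fun a b => f a b ^ 2) x y := by
  set D : Fin n → Fin n → Fin n → ℝ := fun j l k => delta f j (fun a b => gMat f a b l k) x y
    with hD
  have hDs (j l k) : D j l k = D j k l := hf.delta_gMat_symm hx hy j l k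
  have h1 (m : Fin n) : dy m (fun a b => f a b ^ 2) x y = 2 * ∑ i, y i * gMat f x y i m := by
    simp_rw [fun i => hf.gMat_symm hx hy i m, hf.sum_gMat_mul hx hy m]
    ring
  have h2 : ∑ m, (∑ k, chern f m j k x y * y k) * dy m (fun a b => f a b ^ 2) x y =
      ∑ i, ∑ k, y i * y k * (2 * ∑ m, gMat f x y i m * chern f m j k x y) := by
    simp_rw [h1, Finset.mul_sum, Finset.sum_mul]
    rw [← Finset.sum_comm_cycle]
    refine Finset.sum_congr rfl fun i _ => Finset.sum_congr rfl fun k _ =>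
      Finset.sum_congr rfl fun m _ => ?_
    ring
  -- Contraction with the symmetric yⁱyᵏ makes the last two Christoffel terms cancel.
  have h3 : ∑ i, ∑ k, y i * y k * D i j k = ∑ i, ∑ k, y i * y k * D k i j := by
    rw [Finset.sum_comm]
    refine Finset.sum_congr rfl fun i _ => Finset.sum_congr rfl fun k _ => ?_
    rw [hDs k j i]
    ring
  -- The vertical part of δ/δxʲ contributes nothing, by `sum_sum_dy_gMat`.
  have h4 : ∑ i, ∑ k, y i * y k * D j i k = dx j (fun a b => f a b ^ 2) x y := by
    simp only [hD, delta, mul_sub, Finset.sum_sub_distrib, hf.sum_sum_dx_gMat hx hy]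
    have : ∑ i, ∑ k, y i * y k *
        ∑ m, nonlinearConn f m j x y * dy m (fun a b => gMat f a b i k) x y =
        ∑ m, nonlinearConn f m j x y *
          ∑ i, ∑ k, y i * y k * dy m (fun a b => gMat f a b i k) x y := by
      simp_rw [Finset.mul_sum]
      rw [Finset.sum_comm_cycle]
      refine Finset.sum_congr rfl fun m _ => Finset.sum_congr rfl fun i _ =>
        Finset.sum_congr rfl fun k _ => ?_
      ring
    rw [this]
    simp [hf.sum_sum_dy_gMat hx hy]
  rw [h2]
  simp_rw [hf.sum_gMat_mul_chern hx hy]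
  rw [← h4]
  have h5 (i k : Fin n) : y i * y k * (2 * (1 / 2 * (D j i k - D i j k + D k i j))) =
      y i * y k * D j i k - y i * y k * D i j k + y i * y k * D k i j := by ring
  change _ = ∑ i, ∑ k, y i * y k * (2 * (1 / 2 * (D j i k - D i j k + D k i j)))
  simp_rw [h5, Finset.sum_add_distrib, Finset.sum_sub_distrib, h3]
  ring

end IsLocalFinsler

/-- The linear connection with coefficients `Γ` at the point `x` annihilates `f²`: its horizontal
derivatives of `f²` vanish. -/
def IsCompatibleAt (Γ : Fin n → Fin n → Fin n → ℝ) (f : E n → E n → ℝ) (x : E n) : Prop :=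
  ∀ y ≠ 0, ∀ j, dx j (fun a b => f a b ^ 2) x y =
    ∑ m, (∑ k, Γ m j k * y k) * dy m (fun a b => f a b ^ 2) x y

theorem dy_linear (c : Fin n → ℝ) (x y : E n) (i : Fin n) :
    dy i (fun _ b => ∑ k, c k * b k) x y = c i := by
  rw [dy_sum_mul Finset.univ (fun k _ _ => c k) (fun k _ b => b k)
    (fun _ _ => differentiableAt_const _) (fun k _ => differentiableAt_coord k)]
  have h0 (k : Fin n) : dy i (fun _ _ => c k) x y = 0 := by simp [dy]
  simp [h0, dy_coord]

theorem differentiableAt_linear (c : Fin n → ℝ) (y : E n) :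
    DifferentiableAt ℝ (fun b : E n => ∑ k, c k * b k) y :=
  DifferentiableAt.fun_sum fun k _ => (differentiableAt_coord k).const_mul (c k)

namespace IsCompatibleAt

variable {U : Set (E n)} {f : E n → E n → ℝ} {x y : E n} {Γ : Fin n → Fin n → Fin n → ℝ}

/-- Leibniz rule on the compatibility identity: Γ is constant along the fibre, so only yᵏ and
∂f²/∂yᵐ are differentiated. -/
theorem dy_dx_sq (h : IsCompatibleAt Γ f x) (hf : IsLocalFinsler U f) (hx : x ∈ U) (hy : y ≠ 0)
    (i j : Fin n) : dy i (dx j fun a b => f a b ^ 2) x y =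
      ∑ m, (Γ m j i * dy m (fun a b => f a b ^ 2) x y +
        (∑ k, Γ m j k * y k) * dy i (dy m fun a b => f a b ^ 2) x y) := by
  rw [dy_congr_of_ne_zero (g := fun a b => ∑ m, (∑ k, Γ m j k * b k) *
      dy m (fun a b => f a b ^ 2) a b) (fun b hb => h b hb j) hy,
    dy_sum_mul Finset.univ (fun m _ b => ∑ k, Γ m j k * b k) (fun m => dy m fun a b => f a b ^ 2)
      (fun m _ => differentiableAt_linear _ _)
      (fun m _ => (hf.smooth_sq.dy hf.isOpen_prod m).differentiableAt_right hf.isOpen_prod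
        ⟨hx, hy⟩)]
  simp_rw [dy_linear]

theorem dy_dy_dx_sq (h : IsCompatibleAt Γ f x) (hf : IsLocalFinsler U f) (hx : x ∈ U)
    (hy : y ≠ 0) (l i j : Fin n) : dy l (dy i (dx j fun a b => f a b ^ 2)) x y =
      ∑ m, Γ m j i * dy l (dy m fun a b => f a b ^ 2) x y +
      ∑ m, (Γ m j l * dy i (dy m fun a b => f a b ^ 2) x y +
        (∑ k, Γ m j k * y k) * dy l (dy i (dy m fun a b => f a b ^ 2)) x y) := by
  have hs := hf.smooth_sq
  have hW := hf.isOpen_prod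
  -- The two families of products are merged over a sum type so that one application of `dy_sum_mul`
  -- covers both.
  let c : Fin n ⊕ Fin n → E n → E n → ℝ :=
    Sum.elim (fun m _ _ => Γ m j i) (fun m _ b => ∑ k, Γ m j k * b k)
  let F : Fin n ⊕ Fin n → E n → E n → ℝ :=
    Sum.elim (fun m => dy m fun a b => f a b ^ 2) (fun m => dy i (dy m fun a b => f a b ^ 2))
  have e : ∀ b ≠ 0, dy i (dx j fun a b => f a b ^ 2) x b = ∑ p, c p x b * F p x b := by
    intro b hb
    rw [h.dy_dx_sq hf hx hb, Finset.sum_add_distrib, Fintype.sum_sum_type]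
    rfl
  rw [dy_congr_of_ne_zero (g := fun a b => ∑ p, c p a b * F p a b) e hy, dy_sum_mul,
    Fintype.sum_sum_type]
  · have h0 (c : ℝ) : dy l (fun _ _ => c) x y = 0 := by simp [dy]
    simp [c, F, h0, dy_linear]
  · rintro (m | m) -
    · exact differentiableAt_const _
    · exact differentiableAt_linear _ _
  · rintro (m | m) -
    · exact (hs.dy hW m).differentiableAt_right hW ⟨hx, hy⟩
    · exact ((hs.dy hW m).dy hW i).differentiableAt_right hW ⟨hx, hy⟩

/-- In yᵏ ∂²f²/∂xᵏ∂yʲ the term where yˡ in Γᵐₖₗyˡ is differentiated equals ∂f²/∂xʲ by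
torsion-freeness and compatibility. What is left is 2 gⱼₘ Γᵐₖₗ yᵏyˡ. -/
theorem spray_eq (h : IsCompatibleAt Γ f x) (hΓ : ∀ i j k, Γ i j k = Γ i k j)
    (hf : IsLocalFinsler U f) (hx : x ∈ U) (hy : y ≠ 0) (i : Fin n) :
    spray f i x y = 1 / 2 * ∑ j, (∑ k, Γ i j k * y k) * y j := by
  have hs := hf.smooth_sq
  have hW := hf.isOpen_prod
  have key (j : Fin n) : (∑ k, dx k (dy j fun a b => f a b ^ 2) x y * y k) -
      dx j (fun a b => f a b ^ 2) x y =
        4 * ∑ m, gMat f x y j m * (1 / 2 * ∑ k, (∑ l, Γ m k l * y l) * y k) := by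
    have e1 : ∑ k, dx k (dy j fun a b => f a b ^ 2) x y * y k =
        ∑ m, (∑ k, Γ m j k * y k) * dy m (fun a b => f a b ^ 2) x y +
        ∑ m, (∑ k, (∑ l, Γ m k l * y l) * y k) * dy j (dy m fun a b => f a b ^ 2) x y := by
      simp_rw [fun k => hs.dx_dy_comm hW (x := x) (y := y) ⟨hx, hy⟩ k j, h.dy_dx_sq hf hx hy,
        Finset.sum_mul, add_mul, Finset.sum_add_distrib]
      congr 1
      · rw [Finset.sum_comm]
        refine Finset.sum_congr rfl fun m _ => Finset.sum_congr rfl fun k _ => ?_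
        rw [hΓ m j k]
        ring
      · rw [Finset.sum_comm]
        refine Finset.sum_congr rfl fun m _ => Finset.sum_congr rfl fun k _ => ?_
        simp_rw [Finset.sum_mul]
        refine Finset.sum_congr rfl fun l _ => ?_
        ring
    rw [e1, h y hy j, add_sub_cancel_left, Finset.mul_sum]
    refine Finset.sum_congr rfl fun m _ => ?_
    rw [hf.gMat_eq hx hy]
    ring
  rw [spray]
  simp_rw [key, mul_left_comm _ (4 : ℝ), ← Finset.mul_sum, hf.sum_inv_mul_sum hx hy]
  ring

theorem nonlinearConn_eq (h : IsCompatibleAt Γ f x) (hΓ : ∀ i j k, Γ i j k = Γ i k j)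
    (hf : IsLocalFinsler U f) (hx : x ∈ U) (hy : y ≠ 0) (i j : Fin n) :
    nonlinearConn f i j x y = ∑ k, Γ i j k * y k := by
  have e : ∀ b ≠ 0, spray f i x b =
      ∑ j, (1 / 2 * ∑ k, Γ i j k * b k) * b j := fun b hb => by
    rw [h.spray_eq hΓ hf hx hb, Finset.mul_sum]
    simp_rw [mul_assoc]
  have e2 (m : Fin n) : dy j (fun _ b => 1 / 2 * ∑ k, Γ i m k * b k) x y = 1 / 2 * Γ i m j := by
    have := dy_linear (fun k => 1 / 2 * Γ i m k) x y j
    simpa [Finset.mul_sum, mul_assoc] using this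
  rw [nonlinearConn, dy_congr_of_ne_zero
      (g := fun _ b => ∑ j, (1 / 2 * ∑ k, Γ i j k * b k) * b j) e hy,
    dy_sum_mul Finset.univ (fun m _ b => 1 / 2 * ∑ k, Γ i m k * b k) (fun m _ b => b m)
      (fun m _ => (differentiableAt_linear _ _).const_mul _)
      (fun m _ => differentiableAt_coord m)]
  simp only [e2, dy_coord, Finset.sum_add_distrib, mul_ite, mul_one, mul_zero,
    Finset.sum_ite_eq', Finset.mem_univ, if_true]
  have : ∑ m, 1 / 2 * Γ i m j * y m = 1 / 2 * ∑ k, Γ i j k * y k := by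
    rw [Finset.mul_sum]
    refine Finset.sum_congr rfl fun m _ => ?_
    rw [hΓ i m j]
    ring
  rw [this]
  ring

/-- Metric compatibility of Γ: half of two y-derivatives of the identity for ∂f²/∂xʲ. The
third-order term is Nᵐⱼ ∂g/∂yᵐ, exactly what δ/δxʲ subtracts. -/
theorem delta_gMat (h : IsCompatibleAt Γ f x) (hΓ : ∀ i j k, Γ i j k = Γ i k j)
    (hf : IsLocalFinsler U f) (hx : x ∈ U) (hy : y ≠ 0) (j l i : Fin n) :
    delta f j (fun a b => gMat f a b l i) x y =
      ∑ m, Γ m j i * gMat f x y l m + ∑ m, Γ m j l * gMat f x y i m := by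
  have hs := hf.smooth_sq
  have hW := hf.isOpen_prod
  have hg (l i : Fin n) : ∀ p ∈ U ×ˢ ({0}ᶜ : Set (E n)), gMat f p.1 p.2 l i =
      ∑ _ : Fin 1, (1 / 2 : ℝ) * dy l (dy i fun a b => f a b ^ 2) p.1 p.2 :=
    fun p hp => by simpa using hf.gMat_eq hp.1 hp.2 l i
  have e1 : dx j (fun a b => gMat f a b l i) x y =
      1 / 2 * dy l (dy i (dx j fun a b => f a b ^ 2)) x y := by
    rw [dx_congr (f := fun a b => gMat f a b l i) (g := fun a b => ∑ _ : Fin 1, (1 / 2 : ℝ) *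
        dy l (dy i fun a b => f a b ^ 2) a b)
        hW (hg l i) ⟨hx, hy⟩, dx_sum_mul _ (fun _ _ => 1 / 2)
      (fun _ => dy l (dy i fun a b => f a b ^ 2))
      (fun _ _ => ((hs.dy hW i).dy hW l).differentiableAt_left hW ⟨hx, hy⟩)]
    rw [(hs.dy hW i).dx_dy_comm hW ⟨hx, hy⟩,
      dy_congr hW (fun p hp => hs.dx_dy_comm hW hp j i) ⟨hx, hy⟩]
    simp
  have e2 (m : Fin n) : dy m (fun a b => gMat f a b l i) x y =
      1 / 2 * dy l (dy i (dy m fun a b => f a b ^ 2)) x y := by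
    rw [dy_congr (f := fun a b => gMat f a b l i) (g := fun a b => ∑ _ : Fin 1, (1 / 2 : ℝ) *
        dy l (dy i fun a b => f a b ^ 2) a b)
        hW (hg l i) ⟨hx, hy⟩, dy_sum_mul _ (fun _ _ _ => 1 / 2)
      (fun _ => dy l (dy i fun a b => f a b ^ 2)) (fun _ _ => differentiableAt_const _)
      (fun _ _ => ((hs.dy hW i).dy hW l).differentiableAt_right hW ⟨hx, hy⟩)]
    have h0 : dy m (fun _ _ => (2⁻¹ : ℝ)) x y = 0 := by simp [dy]
    rw [(hs.dy hW i).dy_dy_comm hW ⟨hx, hy⟩,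
      dy_congr hW (fun p hp => hs.dy_dy_comm hW hp m i) ⟨hx, hy⟩]
    simp [h0]
  simp only [delta]
  simp_rw [e1, e2, h.nonlinearConn_eq hΓ hf hx hy, h.dy_dy_dx_sq hf hx hy, hf.gMat_eq hx hy,
    Finset.sum_add_distrib, mul_add, Finset.mul_sum (a := (1 / 2 : ℝ))]
  simp only [mul_left_comm _ (1 / 2 : ℝ)]
  ring

/-- If a torsion-free linear connection annihilates `f²`, it is the Chern connection. -/
theorem chern_eq (h : IsCompatibleAt Γ f x) (hΓ : ∀ i j k, Γ i j k = Γ i k j)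
    (hf : IsLocalFinsler U f) (hx : x ∈ U) (hy : y ≠ 0) (i j k : Fin n) :
    chern f i j k x y = Γ i j k := by
  -- The Koszul combination: of the six Γ terms four cancel by symmetry and two coincide.
  have key (l : Fin n) : delta f j (fun a b => gMat f a b l k) x y
      - delta f l (fun a b => gMat f a b j k) x y
      + delta f k (fun a b => gMat f a b l j) x y = 2 * ∑ m, gMat f x y l m * Γ m j k := by
    simp_rw [h.delta_gMat hΓ hf hx hy, fun m => hΓ m l j, fun m => hΓ m l k, fun m => hΓ m k j,
      mul_comm (gMat f x y l _)]
    ring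
  rw [chern]
  simp_rw [key, mul_left_comm _ (2 : ℝ), ← Finset.mul_sum, hf.sum_inv_mul_sum hx hy]
  ring

end IsCompatibleAt

/-- The curvature involves only the spray and its derivatives, so agreement on an open set of (x, y)
suffices. -/
theorem ricciScalar_congr {f g : E n → E n → ℝ} {W : Set (E n × E n)} {x y : E n}
    (hW : IsOpen W) (h : ∀ i, ∀ p ∈ W, spray f i p.1 p.2 = spray g i p.1 p.2)
    (hxy : (x, y) ∈ W) : ricciScalar f x y = ricciScalar g x y := by
  have hdy (i k : Fin n) : ∀ p ∈ W, dy k (spray f i) p.1 p.2 = dy k (spray g i) p.1 p.2 :=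
    fun p hp => dy_congr hW (h i) hp k
  simp only [ricciScalar, riemann, dx_congr hW (h _) hxy, dx_congr hW (hdy _ _) hxy,
    dy_congr hW (hdy _ _) hxy, h _ _ hxy, hdy _ _ _ hxy]

end Coordinates

/-! ### Derivatives of (√(L + b²) + cb)². -/

section Calculus

theorem sqrt_sq_add_sq_add_mul_pos {a b c : ℝ} (ha : 0 < a) (hc : |c| ≤ 1) :
    0 < √(a ^ 2 + b ^ 2) + c * b := by
  have h1 : |b| < √(a ^ 2 + b ^ 2) := Real.lt_sqrt_of_sq_lt (by rw [sq_abs]; nlinarith)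
  have h2 : |c * b| ≤ |b| := by
    rw [abs_mul]
    exact mul_le_of_le_one_left (abs_nonneg b) hc
  linarith [neg_abs_le (c * b)]

/-- With H = √Q + a + rd this is (H²)″ = 2H′² + 2HH″, where the affine part drops out of H″. -/
theorem deriv_deriv_sqrt_add_sq {Q q : ℝ → ℝ} {q' a d : ℝ}
    (hQ : ∀ᶠ r in nhds 0, HasDerivAt Q (q r) r) (hpos : ∀ᶠ r in nhds 0, 0 < Q r)
    (hq : HasDerivAt q q' 0) :
    deriv (deriv fun r => (√(Q r) + (a + r * d)) ^ 2) 0 =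
      2 * (q 0 / (2 * √(Q 0)) + d) ^ 2 +
        (√(Q 0) + a) / √(Q 0) * (q' - q 0 ^ 2 / (2 * Q 0)) := by
  have h1 : deriv (fun r => (√(Q r) + (a + r * d)) ^ 2) =ᶠ[nhds 0]
      fun r => 2 * (√(Q r) + (a + r * d)) * (q r / (2 * √(Q r)) + d) := by
    filter_upwards [hQ, hpos] with r hr hr'
    have h2 : HasDerivAt (fun r => a + r * d) d r := by
      simpa using ((hasDerivAt_id r).mul_const d).const_add a
    have := ((hr.sqrt hr'.ne').fun_add h2).fun_pow 2
    simpa using this.deriv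
  have hQ0 := hQ.self_of_nhds
  have hp0 := hpos.self_of_nhds
  have hs : 0 < √(Q 0) := Real.sqrt_pos.2 hp0
  have h2 : HasDerivAt (fun r => a + r * d) d 0 := by
    simpa using ((hasDerivAt_id (0 : ℝ)).mul_const d).const_add a
  have h3 := hQ0.sqrt hp0.ne'
  have h4 := ((h3.fun_add h2).const_mul 2).fun_mul
    ((hq.fun_div (h3.const_mul 2) (by positivity)).add_const d)
  rw [h1.deriv_eq]
  refine HasDerivAt.deriv (h4.congr_deriv ?_)
  have hsq : Q 0 = √(Q 0) ^ 2 := (Real.sq_sqrt hp0.le).symm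
  generalize √(Q 0) = s at *
  rw [hsq]
  field_simp
  ring

/-- The coefficients of `L'` and `b'` depend only on the values at p, so they are the same for x-
and y-derivatives. -/
theorem hasFDerivAt_sqrt_add_mul_sq {X : Type*} [NormedAddCommGroup X] [NormedSpace ℝ X]
    {L b : X → ℝ} {L' b' : X →L[ℝ] ℝ} {p : X} (c : ℝ) (hL : HasFDerivAt L L' p)
    (hb : HasFDerivAt b b' p) (hpos : 0 < L p + b p ^ 2) :
    HasFDerivAt (fun p => (√(L p + b p ^ 2) + c * b p) ^ 2)
      (((√(L p + b p ^ 2) + c * b p) / √(L p + b p ^ 2)) • L' +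
        (2 * (√(L p + b p ^ 2) + c * b p) * (b p / √(L p + b p ^ 2) + c)) • b') p := by
  have hs : √(L p + b p ^ 2) ≠ 0 := (Real.sqrt_pos.2 hpos).ne'
  have h := (((hL.add (hb.pow 2)).sqrt hpos.ne').add (hb.const_mul c)).pow 2
  refine h.congr_fderiv ?_
  ext v
  simp
  field_simp
  ring

end Calculus

/-! ### The metric √(f² + β²) + cβ in coordinates. -/

section Coordinates

variable {n : ℕ}

namespace IsLocalFinsler

variable {U : Set (E n)} {f : E n → E n → ℝ} {x y : E n}

/-- Expansion of a quadratic form, using g(y,u) = ½ d(f²)(u) and g(y,y) = f². -/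
theorem fundamentalTensor_sub_smul (hf : IsLocalFinsler U f) (hx : x ∈ U) (hy : y ≠ 0)
    (u : E n) (t : ℝ) : fundamentalTensor (f x) y (u - t • y) (u - t • y) =
      fundamentalTensor (f x) y u u - t * fderiv ℝ (fun b => f x b ^ 2) y u +
        t ^ 2 * f x y ^ 2 := by
  have h1 : fderiv ℝ (fun b => f x b ^ 2) y u =
      2 * ∑ i, ∑ j, u i * (gMat f x y i j * y j) := by
    rw [fderiv_apply_eq_sum_dy (fun a b => f a b ^ 2) x y u, Finset.mul_sum]
    refine Finset.sum_congr rfl fun i _ => ?_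
    rw [← Finset.mul_sum, Finset.sum_congr rfl fun j _ => mul_comm _ (y j),
      hf.sum_gMat_mul hx hy]
    ring
  have h2 : ∑ i, ∑ j, u i * (gMat f x y i j * y j) = ∑ i, ∑ j, y i * (gMat f x y i j * u j) := by
    rw [Finset.sum_comm]
    refine Finset.sum_congr rfl fun i _ => Finset.sum_congr rfl fun j _ => ?_
    rw [hf.gMat_symm hx hy]
    ring
  have h3 (i j : Fin n) : (u - t • y) i * (gMat f x y i j * (u - t • y) j) =
      u i * (gMat f x y i j * u j) - t * (u i * (gMat f x y i j * y j)) -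
        t * (y i * (gMat f x y i j * u j)) + t ^ 2 * (y i * y j * gMat f x y i j) := by
    simp only [PiLp.sub_apply, PiLp.smul_apply, smul_eq_mul]
    ring
  rw [hf.fundamentalTensor_eq_sum hx hy, hf.fundamentalTensor_eq_sum hx hy, h1,
    ← hf.sum_sum_gMat hx hy]
  obtain ⟨g, hg⟩ : ∃ g : Fin n → Fin n → ℝ, ∀ i j, gMat f x y i j = g i j :=
    ⟨_, fun _ _ => rfl⟩
  simp only [hg] at h2 h3 ⊢
  have h4 (F : Fin n → Fin n → ℝ) (s : ℝ) : ∑ i, ∑ j, s * F i j = s * ∑ i, ∑ j, F i j := by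
    simp_rw [← Finset.mul_sum]
  simp only [h3, Finset.sum_add_distrib, Finset.sum_sub_distrib, h4, ← h2]
  ring

end IsLocalFinsler

/-- The expression `(f² + β²)^{1/2} + c β` in coordinates. -/
def localRanders (f : E n → E n → ℝ) (β : E n → E n →L[ℝ] ℝ) (c : ℝ) : E n → E n → ℝ :=
  fun x y => √(f x y ^ 2 + β x y ^ 2) + c * β x y

variable {U : Set (E n)} {f : E n → E n → ℝ} {β : E n → E n →L[ℝ] ℝ} {c : ℝ} {x y : E n}

theorem IsLocalFinsler.fundamentalTensor_randers_pos (hf : IsLocalFinsler U f) (hc : |c| ≤ 1)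
    (hx : x ∈ U) {u : E n} (hy : y ≠ 0) (hu : u ≠ 0) :
    0 < fundamentalTensor (localRanders f β c x) y u u := by
  have hS : IsOpen ({0}ᶜ : Set (E n)) := isOpen_compl_singleton
  have hsm := hf.contDiffOn_sq hx
  set L : E n → ℝ := fun w => f x w ^ 2 with hLdef
  set Q : ℝ → ℝ := fun r => L (y + r • u) + (β x y + r * β x u) ^ 2
  set q : ℝ → ℝ := fun r => fderiv ℝ L (y + r • u) u + 2 * (β x y + r * β x u) * β x u
  have hlin (r : ℝ) : HasDerivAt (fun r => β x y + r * β x u) (β x u) r := by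
    simpa using ((hasDerivAt_id r).mul_const (β x u)).const_add (β x y)
  have hQ : ∀ᶠ r in nhds 0, HasDerivAt Q (q r) r := by
    filter_upwards [eventually_line hS hy u] with r hr
    have h1 := hasDerivAt_line ((hsm.contDiffAt (hS.mem_nhds hr)).differentiableAt (by simp))
    simpa using h1.fun_add ((hlin r).fun_pow 2)
  have hpos : ∀ᶠ r in nhds 0, 0 < Q r := by
    filter_upwards [eventually_line hS hy u] with r hr
    have := hf.pos x hx _ hr
    positivity
  have hq : HasDerivAt q (2 * fundamentalTensor (f x) y u u + 2 * β x u ^ 2) 0 := by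
    have hd : DifferentiableAt ℝ (fun w => fderiv ℝ L w u) (y + (0 : ℝ) • u) := by
      have := ((hsm.fderiv_of_isOpen (m := ∞) hS (by simp)).contDiffAt
        (hS.mem_nhds hy)).differentiableAt (by simp)
      simpa using this.clm_apply (differentiableAt_const u)
    have h1 := (hasDerivAt_line hd).add (((hlin 0).const_mul 2).mul_const (β x u))
    refine h1.congr_deriv ?_
    rw [fundamentalTensor_eq hS hsm hy]
    simp only [zero_smul, add_zero]
    ring
  have key : fundamentalTensor (localRanders f β c x) y u u =
      1 / 2 * deriv (deriv fun r => (√(Q r) + (c * β x y + r * (c * β x u))) ^ 2) 0 := by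
    rw [fundamentalTensor_self]
    congr 4
    funext r
    simp only [localRanders, Q, L, map_add, map_smul, smul_eq_mul]
    ring
  have hQ0 : Q 0 = f x y ^ 2 + β x y ^ 2 := by simp [Q, L]
  have hq0 : q 0 = fderiv ℝ L y u + 2 * β x y * β x u := by simp [q]
  have hfy := hf.pos x hx y hy
  have hQp : 0 < Q 0 := hpos.self_of_nhds
  have hsp : 0 < √(Q 0) := Real.sqrt_pos.2 hQp
  have hH : 0 < √(Q 0) + c * β x y := hQ0 ▸ sqrt_sq_add_sq_add_mul_pos hfy hc
  rw [key, deriv_deriv_sqrt_add_sq hQ hpos hq]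
  -- For h = g + β⊗β one has q(0) = 2h(y,u) and Q(0) = h(y,y), so t y is the h-orthogonal projection
  -- of u onto y; `hw` below is then Pythagoras.
  set t := q 0 / (2 * Q 0) with ht
  have hw : 2 * fundamentalTensor (f x) y u u + 2 * β x u ^ 2 - q 0 ^ 2 / (2 * Q 0) =
      2 * (fundamentalTensor (f x) y (u - t • y) (u - t • y) + β x (u - t • y) ^ 2) := by
    have h1 : q 0 ^ 2 / (2 * Q 0) = 2 * t * q 0 - 2 * t ^ 2 * Q 0 := by
      rw [ht]
      field_simp
      ring
    rw [h1, hf.fundamentalTensor_sub_smul hx hy, hQ0, hq0]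
    simp only [map_sub, map_smul, smul_eq_mul]
    ring
  rw [hw]
  -- If u is a multiple of y, the square 2t²(√Q + cβ)² is positive; otherwise the transverse term
  -- is.
  by_cases h0 : u - t • y = 0
  · have hut : u = t • y := sub_eq_zero.1 h0
    have ht0 : t ≠ 0 := fun h => hu (by rw [hut, h, zero_smul])
    have h2 : q 0 / (2 * √(Q 0)) + c * β x u = t * (√(Q 0) + c * β x y) := by
      have h3 : q 0 / (2 * √(Q 0)) = t * √(Q 0) := by
        rw [ht]
        field_simp
        rw [Real.sq_sqrt hQp.le]
      have h4 : β x u = t * β x y := by rw [hut]; simp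
      rw [h3, h4]
      ring
    have h5 : fundamentalTensor (f x) y (0 : E n) 0 = 0 := by simp [fundamentalTensor]
    rw [h2, h0, h5]
    simp only [map_zero]
    positivity
  · have := hf.posDef x hx y _ hy h0
    positivity

/-- `(f² + β²)^{1/2} + c β` is a Finsler metric in coordinates. -/
theorem IsLocalFinsler.randers (hf : IsLocalFinsler U f) (hc : |c| ≤ 1)
    (hβ : SmoothOn (U ×ˢ Set.univ) fun x y => β x y) :
    IsLocalFinsler U (localRanders f β c) where
  isOpen := hf.isOpen
  smooth := by
    have hβ' := ContDiffOn.mono hβ (Set.prod_mono_right (s := U) (Set.subset_univ {0}ᶜ))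
    refine ContDiffOn.add (ContDiffOn.sqrt (ContDiffOn.add hf.smooth_sq (hβ'.pow 2)) ?_)
      (contDiffOn_const.mul hβ')
    intro p hp
    have := hf.pos p.1 hp.1 p.2 hp.2
    positivity
  pos x hx y hy := sqrt_sq_add_sq_add_mul_pos (hf.pos x hx y hy) hc
  homogeneous x hx y r hr := by
    have : (r * f x y) ^ 2 + (r * β x y) ^ 2 = r ^ 2 * (f x y ^ 2 + β x y ^ 2) := by ring
    simp only [localRanders, hf.homogeneous x hx y r hr, map_smul, smul_eq_mul]
    rw [this, Real.sqrt_mul (sq_nonneg r), Real.sqrt_sq hr]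
    ring
  posDef x hx y u hy hu := hf.fundamentalTensor_randers_pos hc hx hy hu

/-- Parallelism makes the horizontal derivative of y ↦ β(y) vanish, and the chain rule in f² and β
does the rest. -/
theorem IsCompatibleAt.randers {Γ : Fin n → Fin n → Fin n → ℝ} (h : IsCompatibleAt Γ f x)
    (hf : IsLocalFinsler U f) (hx : x ∈ U) (hβ : SmoothOn (U ×ˢ Set.univ) fun x y => β x y)
    (hpar : ∀ i j, fderiv ℝ (fun a => β a (basisVec i)) x (basisVec j) =
      ∑ k, Γ k j i * β x (basisVec k)) :
    IsCompatibleAt Γ (localRanders f β c) x := by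
  intro y hy j
  have hW : IsOpen (U ×ˢ (Set.univ : Set (E n))) := hf.isOpen.prod isOpen_univ
  have hpos : 0 < f x y ^ 2 + β x y ^ 2 := by
    have := hf.pos x hx y hy
    positivity
  have hdx := (hasFDerivAt_sqrt_add_mul_sq (L := fun a => f a y ^ 2) (b := fun a => β a y) c
    (hf.smooth_sq.differentiableAt_left hf.isOpen_prod ⟨hx, hy⟩).hasFDerivAt
    (hβ.differentiableAt_left hW ⟨hx, trivial⟩).hasFDerivAt hpos).fderiv
  have hdy := (hasFDerivAt_sqrt_add_mul_sq (L := fun b => f x b ^ 2) (b := fun b => β x b) c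
    (hf.smooth_sq.differentiableAt_right hf.isOpen_prod ⟨hx, hy⟩).hasFDerivAt
    (hβ.differentiableAt_right hW ⟨hx, trivial⟩).hasFDerivAt hpos).fderiv
  have hdyβ (m : Fin n) : dy m (fun a b => β a b) x y = β x (basisVec m) := by
    simp [dy, (β x).fderiv]
  have hdxβ : dx j (fun a b => β a b) x y =
      ∑ m, (∑ k, Γ m j k * y k) * β x (basisVec m) := by
    have e : ∀ p ∈ U ×ˢ (Set.univ : Set (E n)), β p.1 p.2 =
        ∑ i, p.2 i * β p.1 (basisVec i) := fun p _ => by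
      conv_lhs => rw [← sum_smul_basisVec p.2]
      simp
    rw [dx_congr (f := fun a b => β a b) (g := fun a b => ∑ i, b i * β a (basisVec i)) hW e
        ⟨hx, trivial⟩,
      dx_sum_mul Finset.univ (fun i b => b i) (fun i a _ => β a (basisVec i))
        fun i _ => hβ.differentiableAt_left hW (y := basisVec i) ⟨hx, trivial⟩]
    simp_rw [dx, hpar, Finset.mul_sum, Finset.sum_mul]
    rw [Finset.sum_comm]
    refine Finset.sum_congr rfl fun m _ => Finset.sum_congr rfl fun k _ => ?_
    ring
  -- A and B are the partial derivatives of (√(L + b²) + cb)² in L and in b.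
  set A := (√(f x y ^ 2 + β x y ^ 2) + c * β x y) / √(f x y ^ 2 + β x y ^ 2)
  set B := 2 * (√(f x y ^ 2 + β x y ^ 2) + c * β x y) *
    (β x y / √(f x y ^ 2 + β x y ^ 2) + c)
  have ex : dx j (fun a b => localRanders f β c a b ^ 2) x y =
      A * dx j (fun a b => f a b ^ 2) x y + B * dx j (fun a b => β a b) x y := by
    simp only [dx, localRanders]
    rw [hdx]
    rfl
  have ey (m : Fin n) : dy m (fun a b => localRanders f β c a b ^ 2) x y =
      A * dy m (fun a b => f a b ^ 2) x y + B * dy m (fun a b => β a b) x y := by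
    simp only [dy, localRanders]
    rw [hdy]
    rfl
  simp_rw [ex, ey, hdyβ, hdxβ, h y hy j, mul_add, Finset.sum_add_distrib, Finset.mul_sum]
  congr 1 <;> refine Finset.sum_congr rfl fun m _ => ?_ <;> ring

end Coordinates

/-! ### Passage between TM and natural coordinates. -/

section Manifold

variable {n : ℕ} {M : Type*} [TopologicalSpace M] [ChartedSpace (E n) M]

/-- The map `(x, y) ↦ yⁱ ∂/∂xⁱ` inverse to the natural coordinates of `TM` is smooth. -/
theorem contMDiffOn_natural_coordinates [IsManifold (𝓡 n) ∞ M]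
    {e : OpenPartialHomeomorph M (E n)} (he : e ∈ IsManifold.maximalAtlas (𝓡 n) ∞ M) :
    ContMDiffOn 𝓘(ℝ, E n × E n) (𝓡 n).tangent ∞
      (fun p : E n × E n => (⟨e.symm p.1, mfderiv (𝓡 n) (𝓡 n) e.symm p.1 p.2⟩ :
        TangentBundle (𝓡 n) M)) (e.target ×ˢ Set.univ) := by
  have : IsManifold (𝓡 n) 1 M := IsManifold.of_le (n := ∞) (by simp)
  have h1 := (contMDiffOn_symm_of_mem_maximalAtlas he).contMDiffOn_tangentMapWithin (m := ∞)
    (by simp) e.open_target.uniqueMDiffOn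
  have h2 : ContMDiff 𝓘(ℝ, E n × E n) (𝓡 n).tangent ∞
      (fun p : E n × E n => (⟨p.1, p.2⟩ : TangentBundle (𝓡 n) (E n))) := by
    intro p
    rw [Bundle.contMDiffAt_totalSpace]
    refine ⟨contDiff_fst.contMDiff.contMDiffAt, ?_⟩
    have : ContMDiffAt 𝓘(ℝ, E n × E n) 𝓘(ℝ, E n) ∞ (fun p : E n × E n => p.2) p :=
      contDiff_snd.contMDiff.contMDiffAt
    -- On the model space the fibre coordinate of the tangent bundle is just `p.2`.
    convert! this with q
    simp
    rfl
  refine (h1.comp h2.contMDiffOn fun p hp => hp.1).congr fun p hp => ?_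
  simp [tangentMapWithin, mfderivWithin_of_isOpen e.open_target hp.1]

theorem mfderiv_symm_bijective [IsManifold (𝓡 n) ∞ M]
    {e : OpenPartialHomeomorph M (E n)} (he : e ∈ IsManifold.maximalAtlas (𝓡 n) ∞ M)
    {x : E n} (hx : x ∈ e.target) :
    Function.Bijective (mfderiv (𝓡 n) (𝓡 n) e.symm x) := by
  have hd : e.MDifferentiable (𝓡 n) (𝓡 n) :=
    ⟨(contMDiffOn_of_mem_maximalAtlas he).mdifferentiableOn (by simp),
      (contMDiffOn_symm_of_mem_maximalAtlas he).mdifferentiableOn (by simp)⟩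
  exact hd.symm.mfderiv_bijective hx

theorem exists_chart [IsManifold (𝓡 n) ∞ M] (p : M) :
    ∃ e ∈ IsManifold.maximalAtlas (𝓡 n) ∞ M, ∃ x ∈ e.target, e.symm x = p :=
  ⟨chartAt (E n) p, IsManifold.chart_mem_maximalAtlas p, chartAt (E n) p p,
    mem_chart_target _ p, (chartAt (E n) p).left_inv (mem_chart_source _ p)⟩

theorem contDiffOn_localRep [IsManifold (𝓡 n) ∞ M] {F : TangentBundle (𝓡 n) M → ℝ}
    {s : Set (TangentBundle (𝓡 n) M)} (hF : ContMDiffOn (𝓡 n).tangent 𝓘(ℝ) ∞ F s)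
    {e : OpenPartialHomeomorph M (E n)} (he : e ∈ IsManifold.maximalAtlas (𝓡 n) ∞ M)
    {W : Set (E n × E n)} (hW : ∀ p ∈ W, p.1 ∈ e.target ∧
      (⟨e.symm p.1, mfderiv (𝓡 n) (𝓡 n) e.symm p.1 p.2⟩ : TangentBundle (𝓡 n) M) ∈ s) :
    SmoothOn W (localRep F e) :=
  contMDiffOn_iff_contDiffOn.1 (hF.comp ((contMDiffOn_natural_coordinates he).mono
    fun p hp => ⟨(hW p hp).1, trivial⟩) fun p hp => (hW p hp).2)

/-- The coordinate expression of a Finsler metric. -/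
theorem IsFinslerMetric.isLocalFinsler [IsManifold (𝓡 n) ∞ M] {F : TangentBundle (𝓡 n) M → ℝ}
    (hF : IsFinslerMetric F) {e : OpenPartialHomeomorph M (E n)}
    (he : e ∈ IsManifold.maximalAtlas (𝓡 n) ∞ M) :
    IsLocalFinsler e.target (localRep F e) := by
  have hne {x : E n} (hx : x ∈ e.target) {y : E n} (hy : y ≠ 0) :
      mfderiv (𝓡 n) (𝓡 n) e.symm x y ≠ 0 := fun h =>
    hy ((mfderiv_symm_bijective he hx).1 (h.trans (map_zero _).symm))
  refine ⟨e.open_target, contDiffOn_localRep hF.smooth he fun p hp => ⟨hp.1, hne hp.1 hp.2⟩,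
    fun x hx y hy => hF.pos _ (hne hx hy), fun x hx y c hc => ?_, fun x hx y u hy hu => ?_⟩
  · simp only [localRep]
    rw [← hF.homogeneous _ _ c hc]
    congr 2
    exact map_smul (mfderiv (𝓡 n) (𝓡 n) e.symm x) c y
  · have h1 := hF.posDef (e.symm x) _ _ (hne hx hy) (hne hx hu)
    exact (fundamentalTensor_comp (mfderiv (𝓡 n) (𝓡 n) e.symm x).toLinearMap
      (fun w => F ⟨e.symm x, w⟩) y u u).symm ▸ h1

/-- The fibrewise conditions can be tested in charts because `mfderiv` of `e.symm` is bijective.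
Continuity is asked for globally, since the local conditions do not give it at the zero section. -/
theorem isFinslerMetric_of_isLocalFinsler [IsManifold (𝓡 n) ∞ M]
    {F : TangentBundle (𝓡 n) M → ℝ} (hc : Continuous F)
    (hs : ContMDiffOn (𝓡 n).tangent 𝓘(ℝ) ∞ F {v | v.2 ≠ 0})
    (h : ∀ e ∈ IsManifold.maximalAtlas (𝓡 n) ∞ M, IsLocalFinsler e.target (localRep F e)) :
    IsFinslerMetric F := by
  have hne {e : OpenPartialHomeomorph M (E n)} {x : E n} {y : E n}
      (hy : mfderiv (𝓡 n) (𝓡 n) e.symm x y ≠ 0) : y ≠ 0 := by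
    rintro rfl
    exact hy (map_zero _)
  refine ⟨hc, hs, ?_, ?_, ?_⟩
  · rintro ⟨p, v⟩ hv
    obtain ⟨e, he, x, hx, rfl⟩ := exists_chart (n := n) p
    obtain ⟨y, rfl⟩ := (mfderiv_symm_bijective he hx).2 v
    exact (h e he).pos x hx y (hne hv)
  · intro p v c hc
    obtain ⟨e, he, x, hx, rfl⟩ := exists_chart (n := n) p
    obtain ⟨y, rfl⟩ := (mfderiv_symm_bijective he hx).2 v
    rw [← map_smul]
    exact (h e he).homogeneous x hx y c hc
  · intro p v w hv hw
    obtain ⟨e, he, x, hx, rfl⟩ := exists_chart (n := n) p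
    obtain ⟨y, rfl⟩ := (mfderiv_symm_bijective he hx).2 v
    obtain ⟨u, rfl⟩ := (mfderiv_symm_bijective he hx).2 w
    have h1 := (h e he).posDef x hx y u (hne hv) (hne hw)
    exact (fundamentalTensor_comp (mfderiv (𝓡 n) (𝓡 n) e.symm x).toLinearMap
      (fun w => F ⟨e.symm x, w⟩) y u u) ▸ h1

/-- A smooth one-form is a smooth function on the tangent bundle. -/
theorem IsSmoothOneForm.contMDiff [IsManifold (𝓡 n) ∞ M]
    {β : ∀ p : M, TangentSpace (𝓡 n) p →L[ℝ] ℝ} (hβ : IsSmoothOneForm β) :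
    ContMDiff (𝓡 n).tangent 𝓘(ℝ) ∞ fun v : TangentBundle (𝓡 n) M => β v.1 v.2 := by
  have : IsManifold (𝓡 n) 1 M := IsManifold.of_le (n := ∞) (by simp)
  have h1 := hβ.comp (Bundle.contMDiff_proj (n := ∞) (IB := 𝓡 n) (F := E n)
    (TangentSpace (𝓡 n) : M → Type _))
  have h2 := ContMDiff.clm_bundle_apply (n := ∞) (F₁ := E n) (F₂ := ℝ) (IB := 𝓡 n)
    (E₁ := (TangentSpace (𝓡 n) : M → Type _)) (E₂ := Bundle.Trivial M ℝ)
    (b := fun v : TangentBundle (𝓡 n) M => v.1) (v := fun v => v.2) (ϕ := fun v => β v.1)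
    h1 contMDiff_id
  intro v
  have := (Bundle.contMDiffAt_totalSpace.1 (h2 v)).2
  exact this

end Manifold

/-! ### The metric √(f² + β²) + cβ on TM and the conclusion. -/

section Manifold

variable {n : ℕ} {M : Type*} [TopologicalSpace M] [ChartedSpace (E n) M]

/-- The function `(f² + β²)^{1/2} + c β` on `TM`. -/
def randers (f : TangentBundle (𝓡 n) M → ℝ) (β : ∀ p : M, TangentSpace (𝓡 n) p →L[ℝ] ℝ)
    (c : ℝ) : TangentBundle (𝓡 n) M → ℝ :=
  fun v => √(f v ^ 2 + β v.1 v.2 ^ 2) + c * β v.1 v.2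

/-- The one-form `β` in the natural coordinates of `TM`. -/
def oneFormRep (β : ∀ p : M, TangentSpace (𝓡 n) p →L[ℝ] ℝ)
    (e : OpenPartialHomeomorph M (E n)) (x : E n) : E n →L[ℝ] ℝ :=
  (β (e.symm x)).comp (mfderiv (𝓡 n) (𝓡 n) e.symm x)

theorem localRep_randers (f : TangentBundle (𝓡 n) M → ℝ)
    (β : ∀ p : M, TangentSpace (𝓡 n) p →L[ℝ] ℝ) (c : ℝ) (e : OpenPartialHomeomorph M (E n)) :
    localRep (randers f β c) e = localRanders (localRep f e) (oneFormRep β e) c :=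
  rfl

theorem SameSpray.ricciScalarVanishes {F₁ F₂ : TangentBundle (𝓡 n) M → ℝ}
    (h : SameSpray F₁ F₂) (h₂ : RicciScalarVanishes F₂) : RicciScalarVanishes F₁ := by
  intro e he x hx y hy
  rw [ricciScalar_congr (e.open_target.prod isOpen_compl_singleton)
    (fun i p hp => h e he p.1 hp.1 p.2 hp.2 i) (x := x) (y := y) ⟨hx, hy⟩]
  exact h₂ e he x hx y hy

theorem conformal_sq (F : TangentBundle (𝓡 n) M → ℝ) {Λ : M → ℝ} (hΛpos : ∀ p, 0 < Λ p)
    (v : TangentBundle (𝓡 n) M) : conformal F Λ v ^ 2 = F v ^ 2 / Λ v.1 := by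
  rw [conformal, div_pow, Real.sq_sqrt (hΛpos v.1).le]

theorem metricG_eq_randers (F : TangentBundle (𝓡 n) M → ℝ) {Λ : M → ℝ} (hΛpos : ∀ p, 0 < Λ p)
    (om : ∀ p : M, TangentSpace (𝓡 n) p →L[ℝ] ℝ) :
    metricG F Λ om = randers (conformal F Λ) (scaledForm om Λ) 0 := by
  funext v
  simp [metricG, randers, conformal_sq F hΛpos]

theorem metricGβ_eq_randers (F : TangentBundle (𝓡 n) M → ℝ) {Λ : M → ℝ} (hΛpos : ∀ p, 0 < Λ p)
    (om : ∀ p : M, TangentSpace (𝓡 n) p →L[ℝ] ℝ) :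
    metricGβ F Λ om = randers (conformal F Λ) (scaledForm om Λ) 1 := by
  funext v
  simp [metricGβ, metricG, randers, conformal_sq F hΛpos]

variable [IsManifold (𝓡 n) ∞ M] {f : TangentBundle (𝓡 n) M → ℝ}
  {β : ∀ p : M, TangentSpace (𝓡 n) p →L[ℝ] ℝ} {c : ℝ} {e : OpenPartialHomeomorph M (E n)}
  {x y : E n}

theorem smoothOn_oneFormRep
    (hβ : ContMDiff (𝓡 n).tangent 𝓘(ℝ) ∞ fun v : TangentBundle (𝓡 n) M => β v.1 v.2)
    (he : e ∈ IsManifold.maximalAtlas (𝓡 n) ∞ M) :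
    SmoothOn (e.target ×ˢ Set.univ) fun x y => oneFormRep β e x y :=
  contDiffOn_localRep hβ.contMDiffOn (s := Set.univ) he fun _ hp => ⟨hp.1, trivial⟩

theorem IsFinslerMetric.randers (hf : IsFinslerMetric f)
    (hβ : ContMDiff (𝓡 n).tangent 𝓘(ℝ) ∞ fun v : TangentBundle (𝓡 n) M => β v.1 v.2)
    (hc : |c| ≤ 1) : IsFinslerMetric (randers f β c) := by
  refine isFinslerMetric_of_isLocalFinsler ?_ ?_ fun e he => ?_
  · exact ((hf.continuous.pow 2).add (hβ.continuous.pow 2)).sqrt.add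
      (continuous_const.mul hβ.continuous)
  · have h2 : ContMDiffOn (𝓡 n).tangent 𝓘(ℝ, ℝ × ℝ) ∞
        (fun v : TangentBundle (𝓡 n) M => (f v, β v.1 v.2)) {v | v.2 ≠ 0} :=
      hf.smooth.prodMk_space hβ.contMDiffOn
    have h3 : ContDiffOn ℝ ∞ (fun q : ℝ × ℝ => √(q.1 ^ 2 + q.2 ^ 2) + c * q.2)
        {q | 0 < q.1} := by
      -- The square root is smooth here since the first argument, the value of `f`, is positive off
      -- the zero section.
      refine (ContDiffOn.sqrt (by fun_prop) fun q hq => ?_).add (by fun_prop)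
      have : 0 < q.1 := hq
      positivity
    exact h3.contMDiffOn.comp h2 fun v hv => hf.pos v hv
  · rw [localRep_randers]
    exact (hf.isLocalFinsler he).randers hc (smoothOn_oneFormRep hβ he)

/-- The Berwald condition enters here: the coefficients in `dx_sq_eq`, taken at the running vector
w, may be frozen at one fixed y. -/
theorem IsBerwald.isCompatibleAt (hf : IsBerwald f)
    (he : e ∈ IsManifold.maximalAtlas (𝓡 n) ∞ M) (hx : x ∈ e.target) (hy : y ≠ 0) :
    IsCompatibleAt (fun i j k => chern (localRep f e) i j k x y) (localRep f e) x := by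
  intro w hw j
  rw [(hf.isFinslerMetric.isLocalFinsler he).dx_sq_eq hx hw]
  simp_rw [hf.chern_eq e he x hx w y hw hy]

theorem IsBerwald.isCompatibleAt_randers (hf : IsBerwald f)
    (hβ : ContMDiff (𝓡 n).tangent 𝓘(ℝ) ∞ fun v : TangentBundle (𝓡 n) M => β v.1 v.2)
    (hpar : IsParallel f β)
    (he : e ∈ IsManifold.maximalAtlas (𝓡 n) ∞ M) (hx : x ∈ e.target) (hy : y ≠ 0) :
    IsCompatibleAt (fun i j k => chern (localRep f e) i j k x y)
      (localRep (Finsler.randers f β c) e) x := by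
  have hpar' (i j : Fin n) : fderiv ℝ (fun a => oneFormRep β e a (basisVec i)) x (basisVec j) =
      ∑ k, chern (localRep f e) k j i x y * oneFormRep β e x (basisVec k) :=
    sub_eq_zero.1 (hpar e he x hx y hy i j)
  rw [localRep_randers]
  exact (hf.isCompatibleAt he hx hy).randers (hf.isFinslerMetric.isLocalFinsler he) hx
    (smoothOn_oneFormRep hβ he) hpar'

theorem IsBerwald.randers (hf : IsBerwald f)
    (hβ : ContMDiff (𝓡 n).tangent 𝓘(ℝ) ∞ fun v : TangentBundle (𝓡 n) M => β v.1 v.2)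
    (hpar : IsParallel f β) (hc : |c| ≤ 1) : IsBerwald (randers f β c) where
  isFinslerMetric := hf.isFinslerMetric.randers hβ hc
  chern_eq e he x hx y y' hy hy' i j k := by
    have hl := (hf.isFinslerMetric.randers hβ hc).isLocalFinsler he
    have h := hf.isCompatibleAt_randers (c := c) hβ hpar he hx hy
    have hs (i j k : Fin n) := (hf.isFinslerMetric.isLocalFinsler he).chern_symm hx hy i j k
    rw [h.chern_eq hs hl hx hy, h.chern_eq hs hl hx hy']

/-- Both sprays equal ½ Γⁱⱼₖ yʲyᵏ for the Chern coefficients Γ of `f`. -/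
theorem IsBerwald.sameSpray_randers (hf : IsBerwald f)
    (hβ : ContMDiff (𝓡 n).tangent 𝓘(ℝ) ∞ fun v : TangentBundle (𝓡 n) M => β v.1 v.2)
    (hpar : IsParallel f β) (hc : |c| ≤ 1) : SameSpray (Finsler.randers f β c) f := by
  intro e he x hx y hy i
  have hl := hf.isFinslerMetric.isLocalFinsler he
  have hs (i j k : Fin n) := hl.chern_symm hx hy i j k
  rw [(hf.isCompatibleAt_randers hβ hpar he hx hy).spray_eq hs
      ((hf.isFinslerMetric.randers hβ hc).isLocalFinsler he) hx hy,
    (hf.isCompatibleAt he hx hy).spray_eq hs hl hx hy]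

theorem contMDiff_scaledForm {Λ : M → ℝ} (hΛ : ContMDiff (𝓡 n) 𝓘(ℝ) ∞ Λ)
    (hΛpos : ∀ p, 0 < Λ p) {om : ∀ p : M, TangentSpace (𝓡 n) p →L[ℝ] ℝ}
    (hom : IsSmoothOneForm om) :
    ContMDiff (𝓡 n).tangent 𝓘(ℝ) ∞
      fun v : TangentBundle (𝓡 n) M => scaledForm om Λ v.1 v.2 := by
  have : IsManifold (𝓡 n) 1 M := IsManifold.of_le (n := ∞) (by simp)
  have h1 : ContMDiff (𝓡 n).tangent 𝓘(ℝ) ∞ fun v : TangentBundle (𝓡 n) M => Λ v.1 :=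
    hΛ.comp (Bundle.contMDiff_proj (IB := 𝓡 n) (F := E n)
      (TangentSpace (𝓡 n) : M → Type _))
  have h3 : ContDiffOn ℝ ∞ (fun q : ℝ × ℝ => q.1⁻¹ * q.2) {q | 0 < q.1} :=
    (contDiff_fst.contDiffOn.inv fun q hq => ne_of_gt hq).mul contDiff_snd.contDiffOn
  exact contMDiffOn_univ.1 (h3.contMDiffOn.comp (h1.prodMk_space hom.contMDiff).contMDiffOn
    fun v _ => hΛpos v.1)

end Manifold

end Finsler

end

theorem proposition1 {n : ℕ} {M : Type*} [TopologicalSpace M]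
    [ChartedSpace (EuclideanSpace ℝ (Fin n)) M] [IsManifold (𝓡 n) ∞ M]
    (F : TangentBundle (𝓡 n) M → ℝ) (hF : Finsler.IsFinslerMetric F)
    (Λ : M → ℝ) (hΛ : ContMDiff (𝓡 n) 𝓘(ℝ) ∞ Λ) (hΛpos : ∀ p, 0 < Λ p)
    (om : ∀ p : M, TangentSpace (𝓡 n) p →L[ℝ] ℝ) (hom : Finsler.IsSmoothOneForm om)
    (hBerwald : Finsler.IsBerwald (Finsler.conformal F Λ))
    (hRicci : Finsler.RicciScalarVanishes (Finsler.conformal F Λ))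
    (hparallel : Finsler.IsParallel (Finsler.conformal F Λ) (Finsler.scaledForm om Λ)) :
    Finsler.IsBerwald (Finsler.metricG F Λ om) ∧
    Finsler.IsBerwald (Finsler.metricGβ F Λ om) ∧
    Finsler.SameSpray (Finsler.metricGβ F Λ om) (Finsler.conformal F Λ) ∧
    Finsler.RicciScalarVanishes (Finsler.metricGβ F Λ om) := by
  have hβ := Finsler.contMDiff_scaledForm hΛ hΛpos hom
  have hspray := hBerwald.sameSpray_randers hβ hparallel (c := 1) (by simp)
  rw [Finsler.metricG_eq_randers F hΛpos om, Finsler.metricGβ_eq_randers F hΛpos om]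
  exact ⟨hBerwald.randers hβ hparallel (by simp), hBerwald.randers hβ hparallel (by simp),
    hspray, hspray.ricciScalarVanishes hRicci⟩
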